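/- Let $K$ be a field and let $P=(P_n)$ be a non-symmetric $K$-linear operad with unit, generated by a finite set $\Omega$ of operations, each $\omega\in\Omega$ having an arity $\ge 1$; so $P$ is the image of the free non-symmetric operad $F(\Omega)$ under a surjective operad morphism $\pi$. The component $F(\Omega)_n$ has as a basis the tree monomials of arity $n$: planar rooted trees with $n$ free ends, whose internal vertices are labelled by elements of $\Omega$, a vertex labelled $\omega$ having as many children as the arity of $\omega$. Fix a monomial order (a well-ordering of the tree monomials of each arity such that all partial compositions $\circ_i$ are strictly increasing in both arguments), and suppose that the ideal of relations $\ker\pi$ has a finite Gröbner basis $G$, that is, a finite set of nonzero homogeneous elements of $\ker\pi$ such that the leading monomial of every nonzero homogeneous element of $\ker\pi$ is divisible by (contains as a labelled subtree) the leading monomial of some element of $G$. Call a tree monomial normal if it is divisible by no leading monomial of an element of $G$. For a set $Y$ of tree monomials and the alphabet $X=\Omega\cup\{x\}$, let $L(X|Y)\subseteq X^*$ be the language of all tree monomials that are divisible by no element of $Y$, written in Polish notation, where the letter $x$ stands for a free end. Then: 1. For each $n$, the images in $P_n$ of the normal monomials of arity $n$ form a $K$-basis of $P_n$. 2. The set of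 all normal monomials, written in Polish notation, is equal to $L(X|Y)$ for some finite set $Y$ of tree monomials, and it is a deterministic context-free language (that is, it is accepted by final state by a deterministic pushdown automaton). 3. If there are no unary generators (all arities are $\ge2$), then every $P_n$ is finite-dimensional. Whenever every $P_n$ is finite-dimensional, the generating series $P(z)=\sum_{n\ge1}(\dim P_n)z^n$ is algebraic over $\mathbb Z[z]$. If, moreover, the growth is subexponential, that is, if for every real $c>1$ one has $\dim P_n\le c^n$ for all sufficiently large $n$, then $P(z)$ is rational, that is, a quotient of two polynomials with integer coefficients. -/

import Mathlib

/-! ### Labelled planar rooted trees -/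

/-- Planar rooted trees whose internal vertices carry labels from the signature `Ω`, a vertex
labelled `ω` having `ar ω` children; `leaf` is a free end. -/
inductive PTree {Ω : Type*} (ar : Ω → ℕ) : Type _
  | leaf : PTree ar
  | node (ω : Ω) (ts : Fin (ar ω) → PTree ar) : PTree ar

namespace PTree

/-- Position of the first free end of the `j`-th branch when branches have `f l` free ends. -/
def off {n : ℕ} (f : Fin n → ℕ) (j : Fin n) : ℕ := ∑ l ∈ Finset.univ.filter (· < j), f l

theorem exists_loc {n : ℕ} (f : Fin n → ℕ) (i : ℕ) (hi : i < ∑ j, f j) :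
    ∃ j, off f j ≤ i ∧ i < off f j + f j := by
  by_contra! hcon
  have key : ∀ k : ℕ, k ≤ n → ∑ l ∈ Finset.univ.filter (fun l : Fin n => l.1 < k), f l ≤ i := by
    intro k
    induction k with
    | zero => intro _; simp
    | succ k ih =>
      intro hk
      have h1 := hcon ⟨k, hk⟩ (ih (by omega))
      have : Finset.univ.filter (fun l : Fin n => l.1 < k + 1)
          = insert ⟨k, hk⟩ (Finset.univ.filter (fun l : Fin n => l.1 < k)) := by
        ext l; simp [Fin.ext_iff]; omega
      rw [this, Finset.sum_insert (by simp)]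
      have h2 : off f ⟨k, hk⟩ = ∑ l ∈ Finset.univ.filter (fun l : Fin n => l.1 < k), f l := rfl
      omega
  have := key n le_rfl
  rw [Finset.filter_true_of_mem (fun l _ => l.2)] at this
  omega

theorem off_add_le {n : ℕ} (f : Fin n → ℕ) {j k : Fin n} (h : j < k) :
    off f j + f j ≤ off f k := by
  unfold off
  have : insert j (Finset.univ.filter (· < j)) ⊆ Finset.univ.filter (· < k) := by
    intro l; simp only [Finset.mem_insert, Finset.mem_filter, Finset.mem_univ, true_and]
    rintro (rfl | h') <;> order
  have h2 := Finset.sum_le_sum_of_subset (f := f) this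
  rw [Finset.sum_insert (by simp)] at h2
  omega

theorem off_update {n : ℕ} (f : Fin n → ℕ) (j k : Fin n) (v : ℕ) :
    off (Function.update f j v) k + (if j < k then f j else 0)
      = off f k + (if j < k then v else 0) := by
  unfold off
  split_ifs with h
  · have hm : j ∈ Finset.univ.filter (· < k) := by simpa using h
    rw [Finset.sum_update_of_mem hm, ← Finset.sum_sdiff (Finset.singleton_subset_iff.2 hm)]
    simp; omega
  · rw [Finset.sum_update_of_notMem (by simpa using h)]

variable {Ω : Type*} {ar : Ω → ℕ}

/-- The arity of a tree monomial: its number of free ends. -/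
def leaves : PTree ar → ℕ
  | leaf => 1
  | node _ ts => ∑ j, leaves (ts j)

/-- `t.graft i s` attaches the root of `s` to the `i`-th free end of `t` (free ends are counted
from left to right, starting with `0`; nothing happens if there is no such free end). -/
def graft : PTree ar → ℕ → PTree ar → PTree ar
  | leaf, i, s => if i = 0 then s else leaf
  | node ω ts, i, s => node ω fun j =>
      if off (fun l => leaves (ts l)) j ≤ i then
        graft (ts j) (i - off (fun l => leaves (ts l)) j) s
      else ts j

theorem graft_of_le (t : PTree ar) (i : ℕ) (s : PTree ar) (h : t.leaves ≤ i) :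
    t.graft i s = t := by
  induction t generalizing i with
  | leaf => simp [leaves, graft] at h ⊢; omega
  | node ω ts ih =>
    simp only [graft, node.injEq, heq_eq_eq, true_and]
    funext j
    split_ifs with hj
    · apply ih
      by_contra! hlt
      have h1 : ∑ l, leaves (ts l) ≤ i := h
      have h2 : off (fun l => leaves (ts l)) j + leaves (ts j) ≤ ∑ l, leaves (ts l) := by
        unfold off
        rw [add_comm, ← Finset.sum_insert (f := fun l => leaves (ts l)) (by simp)]
        exact Finset.sum_le_sum_of_subset (Finset.subset_univ _)
      omega
    · rfl

theorem graft_node (ω : Ω) (ts : Fin (ar ω) → PTree ar) (i : ℕ) (s : PTree ar) (j : Fin (ar ω))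
    (h1 : off (fun l => leaves (ts l)) j ≤ i)
    (h2 : i < off (fun l => leaves (ts l)) j + leaves (ts j)) :
    (node ω ts).graft i s = node ω
      (Function.update ts j ((ts j).graft (i - off (fun l => leaves (ts l)) j) s)) := by
  simp only [graft, node.injEq, heq_eq_eq, true_and]
  funext k
  rcases lt_trichotomy k j with hk | rfl | hk
  · rw [Function.update_of_ne hk.ne]
    have := off_add_le (fun l => leaves (ts l)) hk
    rw [if_pos (by omega)]
    exact graft_of_le _ _ _ (by omega)
  · simp [h1]
  · rw [Function.update_of_ne hk.ne']
    have := off_add_le (fun l => leaves (ts l)) hk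
    rw [if_neg (by omega)]

theorem leaves_update {n : ℕ} (ts : Fin n → PTree ar) (j : Fin n) (v : PTree ar) :
    (fun l => leaves (Function.update ts j v l))
      = Function.update (fun l => leaves (ts l)) j v.leaves := by
  funext l
  by_cases h : l = j
  · subst h; simp
  · simp [h]

theorem leaves_graft (t : PTree ar) (i : ℕ) (s : PTree ar) (h : i < t.leaves) :
    (t.graft i s).leaves + 1 = t.leaves + s.leaves := by
  induction t generalizing i with
  | leaf =>
    have : i = 0 := by simpa [leaves] using h
    simp [graft, leaves, this, add_comm]
  | node ω ts ih =>
    obtain ⟨j, h1, h2⟩ := exists_loc (fun l => leaves (ts l)) i h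
    rw [graft_node ω ts i s j h1 h2]
    have h3 := ih j (i - off (fun l => leaves (ts l)) j) (by omega)
    simp only [leaves, leaves_update]
    rw [Finset.sum_update_of_mem (Finset.mem_univ j),
      ← Finset.sum_sdiff (Finset.subset_univ {j}) (f := fun l => leaves (ts l)),
      Finset.sum_singleton]
    omega

theorem graft_graft (t : PTree ar) (i : ℕ) (s : PTree ar) (j : ℕ) (u : PTree ar)
    (hi : i < t.leaves) (hj : j < s.leaves) :
    (t.graft i s).graft (i + j) u = t.graft i (s.graft j u) := by
  induction t generalizing i with
  | leaf =>
    have : i = 0 := by simpa [leaves] using hi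
    simp [graft, this]
  | node ω ts ih =>
    obtain ⟨k, h1, h2⟩ := exists_loc (fun l => leaves (ts l)) i hi
    have h3 : i - off (fun l => leaves (ts l)) k < leaves (ts k) := by omega
    have h4 := leaves_graft (ts k) _ s h3
    have h5 := off_update (fun l => leaves (ts l)) k k
      ((ts k).graft (i - off (fun l => leaves (ts l)) k) s).leaves
    simp only [lt_irrefl, if_false, add_zero] at h5
    rw [graft_node ω ts i s k h1 h2, graft_node ω ts i _ k h1 h2, graft_node ω _ (i + j) u k]
    · rw [leaves_update, h5, Function.update_self, Function.update_idem,
        show i + j - off (fun l => leaves (ts l)) k = i - off (fun l => leaves (ts l)) k + j by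
          omega, ih k _ h3]
    · rw [leaves_update, h5]; omega
    · rw [leaves_update, h5, Function.update_self]; omega

theorem graft_comm (t : PTree ar) (i k : ℕ) (s u : PTree ar) (hik : i < k) (hk : k < t.leaves) :
    (t.graft k u).graft i s = (t.graft i s).graft (k + s.leaves - 1) u := by
  induction t generalizing i k with
  | leaf => simp [leaves] at hk; omega
  | node ω ts ih =>
    obtain ⟨a, a1, a2⟩ := exists_loc (fun l => leaves (ts l)) i (hik.trans hk)
    obtain ⟨b, b1, b2⟩ := exists_loc (fun l => leaves (ts l)) k hk
    have a3 : i - off (fun l => leaves (ts l)) a < leaves (ts a) := by omega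
    have b3 : k - off (fun l => leaves (ts l)) b < leaves (ts b) := by omega
    have a4 := leaves_graft (ts a) _ s a3
    have b4 := leaves_graft (ts b) _ u b3
    rw [graft_node ω ts i s a a1 a2, graft_node ω ts k u b b1 b2]
    rcases lt_trichotomy a b with hab | rfl | hab
    · have c1 := off_update (fun l => leaves (ts l)) b a
        ((ts b).graft (k - off (fun l => leaves (ts l)) b) u).leaves
      have c2 := off_update (fun l => leaves (ts l)) a b
        ((ts a).graft (i - off (fun l => leaves (ts l)) a) s).leaves
      rw [if_neg hab.not_gt, if_neg hab.not_gt, add_zero, add_zero] at c1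
      rw [if_pos hab, if_pos hab] at c2
      have hle := off_add_le (fun l => leaves (ts l)) hab
      rw [graft_node ω _ i s a, graft_node ω _ (k + s.leaves - 1) u b]
      · rw [leaves_update, leaves_update, c1, Function.update_of_ne hab.ne,
          Function.update_of_ne hab.ne', Function.update_comm hab.ne']
        rw [show k + s.leaves - 1 - off (Function.update (fun l => leaves (ts l)) a
          ((ts a).graft (i - off (fun l => leaves (ts l)) a) s).leaves) b
            = k - off (fun l => leaves (ts l)) b by omega]
      · rw [leaves_update]; omega
      · rw [leaves_update, Function.update_of_ne hab.ne']; omega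
      · rw [leaves_update, c1]; omega
      · rw [leaves_update, c1, Function.update_of_ne hab.ne]; omega
    · have c1 := off_update (fun l => leaves (ts l)) a a
        ((ts a).graft (k - off (fun l => leaves (ts l)) a) u).leaves
      have c2 := off_update (fun l => leaves (ts l)) a a
        ((ts a).graft (i - off (fun l => leaves (ts l)) a) s).leaves
      simp only [lt_irrefl, if_false, add_zero] at c1 c2
      rw [graft_node ω _ i s a, graft_node ω _ (k + s.leaves - 1) u a]
      · rw [leaves_update, leaves_update, c1, c2, Function.update_self, Function.update_self,
          Function.update_idem, Function.update_idem, ih a _ _ (by omega) b3]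
        rw [show k + s.leaves - 1 - off (fun l => leaves (ts l)) a
          = k - off (fun l => leaves (ts l)) a + s.leaves - 1 by omega]
      · rw [leaves_update, c2]; omega
      · rw [leaves_update, c2, Function.update_self]; omega
      · rw [leaves_update, c1]; omega
      · rw [leaves_update, c1, Function.update_self]; omega
    · have := off_add_le (fun l => leaves (ts l)) hab
      omega

theorem graft_leaf (t : PTree ar) (i : ℕ) : t.graft i leaf = t := by
  induction t generalizing i with
  | leaf => simp [graft]
  | node ω ts ih => simp [graft, ih]

/-- `q.RootedIn t`: the tree `t` is obtained from `q` by grafting trees onto free ends of `q`. -/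
def RootedIn : PTree ar → PTree ar → Prop
  | leaf, _ => True
  | node _ _, leaf => False
  | node ω qs, node ω' ts => ∃ h : ω = ω', ∀ j, RootedIn (qs j) (ts (Fin.cast (congrArg ar h) j))

/-- `q.Divides t`: the tree `t` contains a labelled subtree isomorphic to `q`. -/
def Divides (q : PTree ar) : PTree ar → Prop
  | leaf => q.RootedIn leaf
  | node ω ts => q.RootedIn (node ω ts) ∨ ∃ j, Divides q (ts j)

/-- Polish notation: the letter `none` stands for the free end `x`, and `some ω` for `ω`. -/
def polish : PTree ar → List (Option Ω)
  | leaf => [none]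
  | node ω ts => some ω :: (List.ofFn fun j => polish (ts j)).flatten

/-- The tree `t` avoids every pattern in `Y`. -/
def Avoids (Y : Set (PTree ar)) (t : PTree ar) : Prop := ∀ q ∈ Y, ¬ q.Divides t

/-- The language `L(X|Y)`, with `X = {x} ∪ Ω`: all trees avoiding `Y`, in Polish notation. -/
def avoidanceLanguage (Y : Set (PTree ar)) : Language (Option Ω) :=
  {w | ∃ t : PTree ar, Avoids Y t ∧ t.polish = w}

end PTree

/-! ### Non-symmetric operads -/

/-- A non-symmetric `K`-linear operad with unit, given by its components `P n` and the partial
compositions `a ∘ᵢ b`. Inputs are numbered from `0`. The arity `r = m + n - 1` of a composite is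
passed together with a proof of `r + 1 = m + n`, so that the axioms need no transports. -/
class NSOperad (K : Type*) [Field K] (P : ℕ → Type*) [∀ n, AddCommGroup (P n)]
    [∀ n, Module K (P n)] where
  unit : P 1
  comp {m n r : ℕ} (i : ℕ) (hi : i < m) (hr : r + 1 = m + n) : P m →ₗ[K] P n →ₗ[K] P r
  unit_comp {n : ℕ} (b : P n) : comp 0 one_pos (add_comm n 1) unit b = b
  comp_unit {m : ℕ} (i : ℕ) (hi : i < m) (a : P m) : comp i hi rfl a unit = a
  /-- `(a ∘ᵢ b) ∘ᵢ₊ⱼ c = a ∘ᵢ (b ∘ⱼ c)` -/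
  comp_assoc {m n k r s t : ℕ} (i j : ℕ) (hi : i < m) (hj : j < n) (hij : i + j < r)
    (hr : r + 1 = m + n) (hs : s + 1 = n + k) (ht : t + 1 = r + k) (ht' : t + 1 = m + s)
    (a : P m) (b : P n) (c : P k) :
    comp (i + j) hij ht (comp i hi hr a b) c = comp i hi ht' a (comp j hj hs b c)
  /-- `(a ∘ₗ c) ∘ᵢ b = (a ∘ᵢ b) ∘ₗ₊ₙ₋₁ c` for `i < l` and `b` of arity `n` -/
  comp_comm {m n k r s t : ℕ} (i l : ℕ) (hil : i < l) (hl : l < m) (hi : i < m) (hi' : i < s)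
    (hl' : l + n - 1 < r) (hr : r + 1 = m + n) (hs : s + 1 = m + k) (ht : t + 1 = r + k)
    (ht' : t + 1 = s + n) (a : P m) (b : P n) (c : P k) :
    comp i hi' ht' (comp l hl hs a c) b = comp (l + n - 1) hl' ht (comp i hi hr a b) c

/-- Morphisms of non-symmetric operads. -/
structure NSOperad.Hom (K : Type*) [Field K] (P Q : ℕ → Type*)
    [∀ n, AddCommGroup (P n)] [∀ n, Module K (P n)] [NSOperad K P]
    [∀ n, AddCommGroup (Q n)] [∀ n, Module K (Q n)] [NSOperad K Q] where
  toFun (n : ℕ) : P n →ₗ[K] Q n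
  map_unit : toFun 1 (NSOperad.unit K) = NSOperad.unit K
  map_comp {m n r : ℕ} (i : ℕ) (hi : i < m) (hr : r + 1 = m + n) (a : P m) (b : P n) :
    toFun r (NSOperad.comp (K := K) i hi hr a b)
      = NSOperad.comp (K := K) i hi hr (toFun m a) (toFun n b)

/-! ### The free non-symmetric operad -/

/-- Tree monomials of arity `n`. -/
abbrev TreeMon {Ω : Type*} (ar : Ω → ℕ) (n : ℕ) : Type _ := {t : PTree ar // t.leaves = n}

/-- Composition `a ∘ᵢ b` of tree monomials. -/
def TreeMon.comp {Ω : Type*} {ar : Ω → ℕ} {m n r : ℕ} (i : ℕ) (hi : i < m) (hr : r + 1 = m + n)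
    (a : TreeMon ar m) (b : TreeMon ar n) : TreeMon ar r :=
  ⟨a.1.graft i b.1, by
    have := PTree.leaves_graft a.1 i b.1 (by rw [a.2]; exact hi)
    rw [a.2, b.2] at this
    omega⟩

/-- The components of the free non-symmetric operad generated by `Ω`: formal linear combinations
of tree monomials of a given arity. -/
abbrev FreeNS (K : Type*) [Field K] {Ω : Type*} (ar : Ω → ℕ) (n : ℕ) : Type _ :=
  TreeMon ar n →₀ K

namespace FreeNS

variable {K : Type*} [Field K] {Ω : Type*} {ar : Ω → ℕ}

/-- The bilinear extension of the composition of tree monomials. -/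
noncomputable def comp {m n r : ℕ} (i : ℕ) (hi : i < m) (hr : r + 1 = m + n) :
    FreeNS K ar m →ₗ[K] FreeNS K ar n →ₗ[K] FreeNS K ar r :=
  Finsupp.linearCombination K fun a : TreeMon ar m =>
    (Finsupp.lmapDomain K K (TreeMon.comp i hi hr a) : FreeNS K ar n →ₗ[K] FreeNS K ar r)

theorem comp_single {m n r : ℕ} (i : ℕ) (hi : i < m) (hr : r + 1 = m + n)
    (a : TreeMon ar m) (b : TreeMon ar n) (c d : K) :
    comp i hi hr (Finsupp.single a c) (Finsupp.single b d)
      = Finsupp.single (TreeMon.comp i hi hr a b) (c * d) := by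
  simp [comp, Finsupp.linearCombination_single, Finsupp.mapDomain_single]

noncomputable instance : NSOperad K (FreeNS K ar) where
  unit := Finsupp.single ⟨PTree.leaf, rfl⟩ 1
  comp i hi hr := comp i hi hr
  unit_comp b := by
    induction b using Finsupp.induction_linear with
    | zero => simp
    | add f g hf hg => rw [map_add, hf, hg]
    | single b d =>
      rw [comp_single, one_mul]
      congr 1
  comp_unit i hi a := by
    induction a using Finsupp.induction_linear with
    | zero => simp
    | add f g hf hg => rw [map_add, LinearMap.add_apply, hf, hg]
    | single a d =>
      rw [comp_single, mul_one]
      congr 1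
      exact Subtype.ext (PTree.graft_leaf _ _)
  comp_assoc i j hi hj hij hr hs ht ht' a b c := by
    induction a using Finsupp.induction_linear with
    | zero => simp
    | add f g hf hg => simp only [map_add, LinearMap.add_apply, hf, hg]
    | single a x =>
    induction b using Finsupp.induction_linear with
    | zero => simp
    | add f g hf hg => simp only [map_add, LinearMap.add_apply, hf, hg]
    | single b y =>
    induction c using Finsupp.induction_linear with
    | zero => simp
    | add f g hf hg => simp only [map_add, hf, hg]
    | single c z =>
      simp only [comp_single, mul_assoc]
      congr 1
      exact Subtype.ext
        (PTree.graft_graft a.1 i b.1 j c.1 (by rw [a.2]; exact hi) (by rw [b.2]; exact hj))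
  comp_comm {m n k r s t} i l hil hl hi hi' hl' hr hs ht ht' a b c := by
    induction a using Finsupp.induction_linear with
    | zero => simp
    | add f g hf hg => simp only [map_add, LinearMap.add_apply, hf, hg]
    | single a x =>
    induction b using Finsupp.induction_linear with
    | zero => simp
    | add f g hf hg => simp only [map_add, LinearMap.add_apply, hf, hg]
    | single b y =>
    induction c using Finsupp.induction_linear with
    | zero => simp
    | add f g hf hg => simp only [map_add, LinearMap.add_apply, hf, hg]
    | single c z =>
      simp only [comp_single, mul_right_comm]
      congr 1
      refine Subtype.ext ?_
      have := PTree.graft_comm a.1 i l b.1 c.1 hil (by rw [a.2]; exact hl)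
      rw [b.2] at this
      exact this

end FreeNS

/-! ### Monomial orders and Gröbner bases -/

/-- A monomial order: a well-ordering of the tree monomials of each arity, such that all
compositions are strictly increasing in both arguments. -/
structure TreeMonOrder {Ω : Type*} (ar : Ω → ℕ) where
  lt (n : ℕ) : TreeMon ar n → TreeMon ar n → Prop
  wo (n : ℕ) : IsWellOrder (TreeMon ar n) (lt n)
  comp_left {m n r : ℕ} (i : ℕ) (hi : i < m) (hr : r + 1 = m + n) (a a' : TreeMon ar m)
    (b : TreeMon ar n) :
    lt m a a' → lt r (TreeMon.comp i hi hr a b) (TreeMon.comp i hi hr a' b)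
  comp_right {m n r : ℕ} (i : ℕ) (hi : i < m) (hr : r + 1 = m + n) (a : TreeMon ar m)
    (b b' : TreeMon ar n) :
    lt n b b' → lt r (TreeMon.comp i hi hr a b) (TreeMon.comp i hi hr a b')

section Groebner

variable {K : Type*} [Field K] {Ω : Type*} {ar : Ω → ℕ}

/-- `t` is the leading monomial of `f` with respect to the given order. -/
def TreeMonOrder.IsLeading (o : TreeMonOrder ar) {n : ℕ} (f : FreeNS K ar n)
    (t : TreeMon ar n) : Prop :=
  t ∈ f.support ∧ ∀ s ∈ f.support, s ≠ t → o.lt n s t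

/-- The leading monomials of a set of (homogeneous) elements of the free operad. -/
def leadingMonomials (o : TreeMonOrder ar) (G : Set (Σ n, FreeNS K ar n)) : Set (PTree ar) :=
  {q | ∃ g ∈ G, ∃ t : TreeMon ar g.1, o.IsLeading g.2 t ∧ t.1 = q}

variable {P : ℕ → Type*} [∀ n, AddCommGroup (P n)] [∀ n, Module K (P n)] [NSOperad K P]

/-- `G` is a Gröbner basis of the relation ideal `ker π`: it consists of nonzero elements of the
ideal, and the leading monomial of every nonzero element of the ideal is divisible by the leading
monomial of an element of `G`. -/
def IsGroebnerBasis (π : NSOperad.Hom K (FreeNS K ar) P) (o : TreeMonOrder ar)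
    (G : Set (Σ n, FreeNS K ar n)) : Prop :=
  (∀ g ∈ G, g.2 ≠ 0 ∧ π.toFun g.1 g.2 = 0) ∧
  ∀ (n : ℕ) (f : FreeNS K ar n) (t : TreeMon ar n), π.toFun n f = 0 → o.IsLeading f t →
    ∃ q ∈ leadingMonomials o G, q.Divides t.1

/-- Normal monomials: those divisible by no leading monomial of an element of `G`. -/
def IsNormalMonomial (o : TreeMonOrder ar) (G : Set (Σ n, FreeNS K ar n)) (t : PTree ar) : Prop :=
  ∀ q ∈ leadingMonomials o G, ¬ q.Divides t

end Groebner

/-! ### Deterministic context-free languages -/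

/-- A deterministic pushdown automaton with input alphabet `T`. A transition reads a letter
(`some a`) or nothing (`none`), pops the top stack symbol and pushes a word (first letter on
top). If a move reading nothing is possible, then no move reading a letter is. -/
structure DPDA (T : Type*) where
  State : Type
  Stack : Type
  finState : Finite State
  finStack : Finite Stack
  start : State
  bottom : Stack
  accept : Set State
  step : State → Option T → Stack → Option (State × List Stack)
  det : ∀ q Z, (step q none Z).isSome → ∀ a, step q (some a) Z = none

namespace DPDA

variable {T : Type*} (M : DPDA T)

/-- One move between configurations (state, remaining input, stack with its top first). -/
inductive Move : M.State × List T × List M.Stack → M.State × List T × List M.Stack → Prop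
  | read {q q' : M.State} {a : T} {w : List T} {Z : M.Stack} {γ δ : List M.Stack}
      (h : M.step q (some a) Z = some (q', δ)) : Move (q, a :: w, Z :: γ) (q', w, δ ++ γ)
  | silent {q q' : M.State} {w : List T} {Z : M.Stack} {γ δ : List M.Stack}
      (h : M.step q none Z = some (q', δ)) : Move (q, w, Z :: γ) (q', w, δ ++ γ)

/-- The language accepted by final state. -/
def language : Language T :=
  {w | ∃ q ∈ M.accept, ∃ γ : List M.Stack,
    Relation.ReflTransGen M.Move (M.start, w, [M.bottom]) (q, [], γ)}

end DPDA

/-- Deterministic context-free languages: those of deterministic pushdown automata. -/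
def Language.IsDeterministicContextFree {T : Type*} (L : Language T) : Prop :=
  ∃ M : DPDA T, M.language = L

/-! ### Generating series -/

/-- The generating series `∑ dim P(n) zⁿ`. -/
noncomputable def operadSeries (K : Type*) [Field K] (P : ℕ → Type*) [∀ n, AddCommGroup (P n)]
    [∀ n, Module K (P n)] : PowerSeries ℤ :=
  PowerSeries.mk fun n => (Module.finrank K (P n) : ℤ)

/-- The sequence grows subexponentially: it is eventually below `cⁿ` for every `c > 1`. -/
def IsSubexponential (a : ℕ → ℕ) : Prop :=
  ∀ c : ℝ, 1 < c → ∀ᶠ n in Filter.atTop, (a n : ℝ) ≤ c ^ n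

/-- A power series is rational if it is a quotient of two polynomials. -/
def PowerSeries.IsRational (F : PowerSeries ℤ) : Prop :=
  ∃ p q : Polynomial ℤ, q ≠ 0 ∧ (q : PowerSeries ℤ) * F = (p : PowerSeries ℤ)

/-!
The proof has three parts.

*Basis.* Composition of an element of `ker π` with monomials yields elements of `ker π` and, by
monotonicity of the order, composes leading monomials in the same way. A tree monomial divisible by
a leading monomial of `G` is therefore the leading monomial of a relation
(`exists_relation_of_divides`). Reduction by well-founded induction shows that normal monomials
span; they are independent since the leading monomial of a relation is never normal.

*Language.* Avoiding finitely many patterns is decided by a finite bottom-up tree automaton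
(`PTree.exists_automaton`), whose state records the subtrees of patterns found at the root. A
pushdown automaton reading Polish notation from left to right keeps the unfinished vertices on its
stack, together with the states of their completed branches, and so computes the state of the tree
(`PTree.isDeterministicContextFree_of_automaton`).

*Series.* Let `f s` count, by arity, the trees of state `s`. Unique readability gives a system of
polynomial equations `f = Φ(z, f)`. The constant part of its Jacobian matrix `J` comes from the
unary vertices. A cycle among these would give infinitely many normal monomials of the same arity,
so it is nilpotent and `1 - J` is nonsingular (`PolySystem.det_one_sub_jacobian_ne_zero`).
Differentiating the system yields `(1 - J) df = 0` in the Kähler differentials over `ℚ(z)` of the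
field generated by the `f s`. These differentials vanish, so that the field is algebraic over
`ℚ(z)` (`PolySystem.isAlgebraic`).

For rationality, say that `s` depends on `s'` if some tree of state `s` is built from branches one
of which leads to `s'`. If a production of `s` has two branches that both depend on `s`, then
`X ^ m * f s ^ 2 ≤ f s` coefficientwise, which forces exponential growth
(`PolySystem.not_isSubexponential_of_branching`). Otherwise the system is linear on each strongly
connected component of the dependency graph, with coefficients coming from lower components. By
induction these are rational, and Cramer's rule, with the nonsingular minor of `1 - J`, shows that
the `f s` of the component are rational too (`PolySystem.mem_subfield_of_not_branching`).
-/

/-! ### Leading monomials of relations and normal forms -/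

namespace PTree

theorem off_add_le_sum {n : ℕ} (f : Fin n → ℕ) (j : Fin n) : off f j + f j ≤ ∑ l, f l := by
  unfold off
  rw [add_comm, ← Finset.sum_insert (f := f) (by simp)]
  exact Finset.sum_le_sum_of_subset (Finset.subset_univ _)

variable {Ω : Type*} {ar : Ω → ℕ}

/-- A property of trees that is stable under grafting onto free ends passes from `q` to every tree
that has `q` at its root. -/
theorem of_rootedIn {q t : PTree ar} (h : q.RootedIn t) (p : PTree ar → Prop)
    (hp : ∀ a i s, i < a.leaves → p a → p (a.graft i s)) (hq : p q) : p t := by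
  classical
  induction q generalizing t p with
  | leaf =>
    have := hp leaf 0 t (by simp [leaves]) hq
    simpa [graft] using this
  | node ω qs ih =>
    cases t with
    | leaf => exact h.elim
    | node ω' ts =>
      obtain ⟨rfl, h⟩ := h
      -- The branches of `q` are replaced by those of `t` one at a time; growing one branch by
      -- grafting is a grafting onto the whole tree.
      have key : ∀ A : Finset (Fin (ar ω)), p (node ω fun j => if j ∈ A then ts j else qs j) := by
        intro A
        induction A using Finset.induction_on with
        | empty => simpa using hq
        | insert j A hj ihA =>
          set us : Fin (ar ω) → PTree ar := fun j => if j ∈ A then ts j else qs j with hus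
          have h1 : us j = qs j := by simp [hus, hj]
          have h2 := ih j (h j) (fun u => p (node ω (Function.update us j u))) (by
            intro a i s hi ha
            have h3 := hp _ (off (fun l => leaves (Function.update us j a l)) j + i) s ?_ ha
            · rw [graft_node ω _ _ s j (by omega)
                (by rw [Function.update_self]; omega), Function.update_idem,
                Function.update_self] at h3
              simpa using h3
            · have h4 : off (fun l => leaves (Function.update us j a l)) j
                  + leaves (Function.update us j a j)
                  ≤ ∑ l, leaves (Function.update us j a l) := off_add_le_sum _ _
              rw [Function.update_self] at h4
              simp only [leaves]
              omega) (by rw [← h1, Function.update_eq_self]; exact ihA)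
          convert h2 using 2
          funext l
          by_cases hl : l = j
          · subst hl; simp
          · simp [hus, hl]
      simpa using key Finset.univ

/-- Each branch of a tree arises by grafting onto the tree with that branch cut off. -/
theorem node_eq_graft (ω : Ω) (ts : Fin (ar ω) → PTree ar) (j : Fin (ar ω)) :
    ∃ a i, i < leaves a ∧ a.graft i (ts j) = node ω ts := by
  refine ⟨node ω (Function.update ts j leaf),
    off (fun l => leaves (Function.update ts j leaf l)) j, ?_, ?_⟩
  · have h4 : off (fun l => leaves (Function.update ts j leaf l)) j
        + leaves (Function.update ts j leaf j)
        ≤ ∑ l, leaves (Function.update ts j leaf l) := off_add_le_sum _ _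
    rw [Function.update_self] at h4
    simp only [leaves] at h4 ⊢
    omega
  · rw [graft_node ω _ _ _ j le_rfl (by simp [leaves]), Function.update_idem]
    simp [graft]

/-- A property of trees that is stable under grafting on both sides passes from a tree to all its
multiples. -/
theorem of_divides {q t : PTree ar} (h : q.Divides t) (p : PTree ar → Prop)
    (hp : ∀ a i s, i < leaves a → p a → p (a.graft i s))
    (hp' : ∀ a i s, i < leaves a → p s → p (a.graft i s)) (hq : p q) : p t := by
  induction t with
  | leaf => exact of_rootedIn h p hp hq
  | node ω ts ih =>
    rcases h with h | ⟨j, h⟩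
    · exact of_rootedIn h p hp hq
    · obtain ⟨a, i, hi, he⟩ := node_eq_graft ω ts j
      rw [← he]
      exact hp' a i _ hi (ih j h)

end PTree

section Groebner

variable {K : Type*} [Field K] {Ω : Type*} {ar : Ω → ℕ}

theorem TreeMonOrder.IsLeading.mapDomain {o : TreeMonOrder ar} {m n : ℕ} {f : FreeNS K ar m}
    {t : TreeMon ar m} (h : o.IsLeading f t) (φ : TreeMon ar m → TreeMon ar n)
    (hφ : ∀ a b, o.lt m a b → o.lt n (φ a) (φ b)) :
    o.IsLeading (Finsupp.mapDomain φ f : FreeNS K ar n) (φ t) := by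
  classical
  have := o.wo m
  have := o.wo n
  have hinj : Function.Injective φ := by
    intro a b hab
    rcases trichotomous_of (o.lt m) a b with h | h | h
    · exact absurd (hab ▸ hφ a b h) (irrefl_of (o.lt n) _)
    · exact h
    · exact absurd (hab ▸ hφ b a h) (irrefl_of (o.lt n) _)
  constructor
  · rw [Finsupp.mapDomain_support_of_injective hinj]
    exact Finset.mem_image_of_mem _ h.1
  · intro s hs hst
    rw [Finsupp.mapDomain_support_of_injective hinj, Finset.mem_image] at hs
    obtain ⟨a, ha, rfl⟩ := hs
    exact hφ _ _ (h.2 a ha fun he => hst (he ▸ rfl))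

theorem TreeMonOrder.IsLeading.unique {o : TreeMonOrder ar} {n : ℕ} {f : FreeNS K ar n}
    {s t : TreeMon ar n} (hs : o.IsLeading f s) (ht : o.IsLeading f t) : s = t := by
  have := o.wo n
  by_contra hne
  exact asymm_of (o.lt n) (hs.2 t ht.1 (Ne.symm hne)) (ht.2 s hs.1 hne)

theorem TreeMonOrder.exists_isLeading (o : TreeMonOrder ar) {n : ℕ} {f : FreeNS K ar n}
    (hf : f ≠ 0) : ∃ t, o.IsLeading f t := by
  classical
  have := o.wo n
  let := linearOrderOfSTO (o.lt n)
  obtain ⟨t, ht, hmax⟩ := f.support.exists_max_image id (Finsupp.support_nonempty_iff.2 hf)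
  exact ⟨t, ht, fun s hs hst => lt_of_le_of_ne (hmax s hs) hst⟩

theorem finite_leadingMonomials (o : TreeMonOrder ar) {G : Set (Σ n, FreeNS K ar n)}
    (hG : G.Finite) : (leadingMonomials o G).Finite := by
  have : leadingMonomials o G
      = ⋃ g ∈ G, {q | ∃ t : TreeMon ar g.1, o.IsLeading g.2 t ∧ t.1 = q} := by
    ext q
    simp [leadingMonomials]
  rw [this]
  refine hG.biUnion fun g _ => Set.Subsingleton.finite ?_
  rintro _ ⟨s, hs, rfl⟩ _ ⟨t, ht, rfl⟩
  rw [hs.unique ht]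

theorem FreeNS.comp_single_right {m n r : ℕ} (i : ℕ) (hi : i < m) (hr : r + 1 = m + n)
    (f : FreeNS K ar m) (b : TreeMon ar n) :
    FreeNS.comp i hi hr f (Finsupp.single b 1)
      = (Finsupp.mapDomain (fun a => TreeMon.comp i hi hr a b) f : FreeNS K ar r) := by
  induction f using Finsupp.induction_linear with
  | zero => simp
  | add f g hf hg => rw [map_add, LinearMap.add_apply, hf, hg, Finsupp.mapDomain_add]
  | single a c => rw [FreeNS.comp_single, Finsupp.mapDomain_single, mul_one]

theorem FreeNS.comp_single_left {m n r : ℕ} (i : ℕ) (hi : i < m) (hr : r + 1 = m + n)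
    (a : TreeMon ar m) (f : FreeNS K ar n) :
    FreeNS.comp i hi hr (Finsupp.single a 1) f
      = (Finsupp.mapDomain (TreeMon.comp i hi hr a) f : FreeNS K ar r) := by
  induction f using Finsupp.induction_linear with
  | zero => simp
  | add f g hf hg => rw [map_add, hf, hg, Finsupp.mapDomain_add]
  | single b c => rw [FreeNS.comp_single, Finsupp.mapDomain_single, one_mul]

variable {P : ℕ → Type*} [∀ n, AddCommGroup (P n)] [∀ n, Module K (P n)] [NSOperad K P]

/-- A tree monomial divisible by the leading monomial of a relation is itself the leading monomial
of a relation, as composition with monomials preserves both relations and leading monomials. -/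
theorem exists_relation_of_divides (π : NSOperad.Hom K (FreeNS K ar) P) (o : TreeMonOrder ar)
    {m n : ℕ} {g : FreeNS K ar m} {q : TreeMon ar m} (hg : π.toFun m g = 0)
    (hq : o.IsLeading g q) (t : TreeMon ar n) (h : q.1.Divides t.1) :
    ∃ f : FreeNS K ar n, π.toFun n f = 0 ∧ o.IsLeading f t := by
  suffices H : ∃ n, ∃ t' : TreeMon ar n, t'.1 = t.1 ∧
      ∃ f : FreeNS K ar n, π.toFun n f = 0 ∧ o.IsLeading f t' by
    obtain ⟨n', ⟨t', ht'⟩, rfl, f, hf⟩ := H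
    obtain rfl : n' = n := ht'.symm.trans t.2
    exact ⟨f, hf⟩
  refine PTree.of_divides h (fun u => ∃ n, ∃ t' : TreeMon ar n, t'.1 = u ∧
      ∃ f : FreeNS K ar n, π.toFun n f = 0 ∧ o.IsLeading f t') ?_ ?_ ⟨m, q, rfl, g, hg, hq⟩
  · rintro _ i s hi ⟨k, a, rfl, f, hf, hl⟩
    rw [a.2] at hi
    have hr : k + s.leaves - 1 + 1 = k + s.leaves := by omega
    let b : TreeMon ar s.leaves := ⟨s, rfl⟩
    refine ⟨_, TreeMon.comp i hi hr a b, rfl,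
      FreeNS.comp i hi hr f (Finsupp.single b 1), ?_, ?_⟩
    · have := π.map_comp i hi hr f (Finsupp.single b 1)
      rw [hf, map_zero, LinearMap.zero_apply] at this
      exact this
    · rw [FreeNS.comp_single_right]
      exact hl.mapDomain _ fun x y => o.comp_left i hi hr x y b
  · rintro a i _ hi ⟨k, s, rfl, f, hf, hl⟩
    have hr : a.leaves + k - 1 + 1 = a.leaves + k := by omega
    let b : TreeMon ar a.leaves := ⟨a, rfl⟩
    refine ⟨_, TreeMon.comp i hi hr b s, rfl,
      FreeNS.comp i hi hr (Finsupp.single b 1) f, ?_, ?_⟩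
    · have := π.map_comp i hi hr (Finsupp.single b 1) f
      rw [hf, map_zero] at this
      exact this
    · rw [FreeNS.comp_single_left]
      exact hl.mapDomain _ fun x y => o.comp_right i hi hr b x y

/-- A nontrivial relation between normal monomials would have a normal leading monomial. -/
theorem IsGroebnerBasis.linearIndependent {π : NSOperad.Hom K (FreeNS K ar) P}
    {o : TreeMonOrder ar} {G : Set (Σ n, FreeNS K ar n)} (hG : IsGroebnerBasis π o G) (n : ℕ) :
    LinearIndependent K (fun t : {t : TreeMon ar n // IsNormalMonomial o G t.1} =>
      π.toFun n (Finsupp.single t.1 1)) := by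
  classical
  rw [linearIndependent_iff]
  intro l hl
  by_contra hne
  let f : FreeNS K ar n := Finsupp.mapDomain Subtype.val l
  have hinj : Function.Injective
      (Subtype.val : {t : TreeMon ar n // IsNormalMonomial o G t.1} → TreeMon ar n) :=
    Subtype.val_injective
  have hf : f ≠ 0 := fun h0 => hne (Finsupp.mapDomain_injective hinj (by
    rw [Finsupp.mapDomain_zero]; exact h0))
  obtain ⟨t, ht⟩ := o.exists_isLeading hf
  have hπf : π.toFun n f = 0 := by
    rw [← hl]
    simp only [f, Finsupp.mapDomain, Finsupp.linearCombination_apply, Finsupp.sum, map_sum]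
    refine Finset.sum_congr rfl fun a _ => ?_
    rw [← map_smul, Finsupp.smul_single, smul_eq_mul, mul_one]
  obtain ⟨q, hq, hdiv⟩ := hG.2 n f t hπf ht
  have hmem := ht.1
  rw [Finsupp.mapDomain_support_of_injective hinj, Finset.mem_image] at hmem
  obtain ⟨a, -, rfl⟩ := hmem
  exact a.2 q hq hdiv

/-- Reduction to normal form: a monomial that is not normal is congruent modulo relations to a
combination of smaller ones. -/
theorem IsGroebnerBasis.span_eq_top {π : NSOperad.Hom K (FreeNS K ar) P}
    {o : TreeMonOrder ar} {G : Set (Σ n, FreeNS K ar n)} (hG : IsGroebnerBasis π o G) (n : ℕ)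
    (hπ : Function.Surjective (π.toFun n)) :
    Submodule.span K (Set.range (fun t : {t : TreeMon ar n // IsNormalMonomial o G t.1} =>
      π.toFun n (Finsupp.single t.1 1))) = ⊤ := by
  classical
  have := o.wo n
  set V := Submodule.span K (Set.range (fun t : {t : TreeMon ar n // IsNormalMonomial o G t.1} =>
      π.toFun n (Finsupp.single t.1 1))) with hV
  have key : ∀ t : TreeMon ar n, π.toFun n (Finsupp.single t 1) ∈ V := by
    intro t
    induction t using (IsWellFounded.wf (r := o.lt n)).induction with
    | _ t ih =>
    by_cases ht : IsNormalMonomial o G t.1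
    · exact Submodule.subset_span ⟨⟨t, ht⟩, rfl⟩
    · simp only [IsNormalMonomial, not_forall, not_not] at ht
      obtain ⟨q, ⟨g, hg, q', hq', rfl⟩, hdiv⟩ := ht
      obtain ⟨f, hf, hl⟩ := exists_relation_of_divides π o (hG.1 g hg).2 hq' t hdiv
      have hsum : f t • π.toFun n (Finsupp.single t 1)
          = - ∑ s ∈ f.support.erase t, f s • π.toFun n (Finsupp.single s 1) := by
        rw [eq_neg_iff_add_eq_zero,
          Finset.add_sum_erase _ (fun s => f s • π.toFun n (Finsupp.single s 1)) hl.1, ← hf]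
        conv_rhs => rw [← Finsupp.sum_single f, Finsupp.sum, map_sum]
        refine Finset.sum_congr rfl fun s _ => ?_
        rw [← map_smul, Finsupp.smul_single, smul_eq_mul, mul_one]
      have h1 : f t • π.toFun n (Finsupp.single t 1) ∈ V := by
        rw [hsum]
        refine V.neg_mem (V.sum_mem fun s hs => V.smul_mem _ (ih s ?_))
        exact hl.2 s (Finset.mem_of_mem_erase hs) (Finset.ne_of_mem_erase hs)
      exact (V.smul_mem_iff (Finsupp.mem_support_iff.1 hl.1)).1 h1
  rw [eq_top_iff]
  rintro x -
  obtain ⟨f, rfl⟩ := hπ x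
  rw [← Finsupp.sum_single f, Finsupp.sum, map_sum]
  refine V.sum_mem fun s _ => ?_
  have : (Finsupp.single s (f s) : FreeNS K ar n) = f s • Finsupp.single s 1 := by
    rw [Finsupp.smul_single, smul_eq_mul, mul_one]
  rw [this, map_smul]
  exact V.smul_mem _ (key s)

end Groebner

/-! ### A finite tree automaton recognizing the trees that avoid finitely many patterns -/

namespace PTree

variable {Ω : Type*} {ar : Ω → ℕ}

/-- The set of all subtrees of a tree that consist of a vertex and everything above it. -/
def subtrees : PTree ar → Set (PTree ar)
  | leaf => {leaf}
  | node ω ts => insert (node ω ts) (⋃ j, subtrees (ts j))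

theorem finite_subtrees (t : PTree ar) : t.subtrees.Finite := by
  induction t with
  | leaf => exact Set.finite_singleton _
  | node ω ts ih => exact (Set.finite_iUnion ih).insert _

theorem self_mem_subtrees (t : PTree ar) : t ∈ t.subtrees := by
  cases t with
  | leaf => exact Set.mem_singleton _
  | node ω ts => exact Set.mem_insert _ _

theorem child_mem_subtrees {t : PTree ar} {ω : Ω} {qs : Fin (ar ω) → PTree ar}
    (h : node ω qs ∈ t.subtrees) (j : Fin (ar ω)) : qs j ∈ t.subtrees := by
  induction t with
  | leaf => simp [subtrees] at h
  | node ω' ts ih =>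
    rcases h with h | h
    · cases h
      exact Or.inr (Set.mem_iUnion.2 ⟨j, self_mem_subtrees _⟩)
    · obtain ⟨i, hi⟩ := Set.mem_iUnion.1 h
      exact Or.inr (Set.mem_iUnion.2 ⟨i, ih i hi⟩)

theorem avoids_node {Y : Set (PTree ar)} {ω : Ω} {ts : Fin (ar ω) → PTree ar} :
    Avoids Y (node ω ts) ↔ (∀ q ∈ Y, ¬ q.RootedIn (node ω ts)) ∧ ∀ j, Avoids Y (ts j) := by
  simp only [Avoids, Divides, not_or, not_exists]
  exact ⟨fun h => ⟨fun q hq => (h q hq).1, fun j q hq => (h q hq).2 j⟩,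
    fun h q hq => ⟨h.1 q hq, fun j => h.2 j q hq⟩⟩

/-- Avoidance of finitely many patterns is decided by a finite deterministic bottom-up tree
automaton: the state of a tree records which subtrees of the patterns it has at its root, and
whether it avoids all patterns. -/
theorem exists_automaton {Y : Set (PTree ar)} (hY : Y.Finite) :
    ∃ (n : ℕ) (st : PTree ar → Fin n) (δ : ∀ ω, (Fin (ar ω) → Fin n) → Fin n) (F : Set (Fin n)),
      (∀ ω ts, st (node ω ts) = δ ω fun j => st (ts j)) ∧ ∀ t, Avoids Y t ↔ st t ∈ F := by
  classical
  let Q : Set (PTree ar) := ⋃ q ∈ Y, q.subtrees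
  have hQ : Finite Q := (hY.biUnion fun q _ => q.finite_subtrees).to_subtype
  have hYQ : ∀ q ∈ Y, q ∈ Q := fun q hq => Set.mem_biUnion hq q.self_mem_subtrees
  have hchild : ∀ (ω : Ω) (qs : Fin (ar ω) → PTree ar) (j), node ω qs ∈ Q → qs j ∈ Q := by
    intro ω qs j h
    obtain ⟨q, hq, h⟩ := Set.mem_iUnion₂.1 h
    exact Set.mem_biUnion hq (child_mem_subtrees h j)
  let τ : PTree ar → Set Q × Prop := fun t => ({q | q.1.RootedIn t}, Avoids Y t)
  have hroot : ∀ (ω : Ω) (ts ts' : Fin (ar ω) → PTree ar), (∀ j, τ (ts j) = τ (ts' j)) →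
      ∀ q ∈ Q, q.RootedIn (node ω ts) → q.RootedIn (node ω ts') := by
    intro ω ts ts' h q hq hr
    cases q with
    | leaf => trivial
    | node ω' qs =>
      obtain ⟨rfl, hr⟩ := hr
      refine ⟨rfl, fun j => ?_⟩
      have h1 := congrArg Prod.fst (h j)
      exact (Set.ext_iff.1 h1 ⟨qs j, hchild _ qs j hq⟩).1 (hr j)
  have hcongr : ∀ (ω : Ω) (ts ts' : Fin (ar ω) → PTree ar), (∀ j, τ (ts j) = τ (ts' j)) →
      τ (node ω ts) = τ (node ω ts') := by
    intro ω ts ts' h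
    have h' : ∀ j, τ (ts' j) = τ (ts j) := fun j => (h j).symm
    refine Prod.ext ?_ ?_
    · ext q
      exact ⟨hroot ω ts ts' h q q.2, hroot ω ts' ts h' q q.2⟩
    · have h2 : ∀ j, Avoids Y (ts j) = Avoids Y (ts' j) := fun j => congrArg Prod.snd (h j)
      simp only [τ, avoids_node, h2, eq_iff_iff]
      refine and_congr_left fun _ => forall₂_congr fun q hq => not_congr
        ⟨hroot ω ts ts' h q (hYQ q hq), hroot ω ts' ts h' q (hYQ q hq)⟩
  let e := Finite.equivFin (Set Q × Prop)
  refine ⟨_, fun t => e (τ t), fun ω => Function.extend (fun ts j => e (τ (ts j)))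
    (fun ts => e (τ (node ω ts))) (fun _ => e (τ leaf)), {s | (e.symm s).2}, ?_, ?_⟩
  · intro ω ts
    have hfac : Function.FactorsThrough (fun us : Fin (ar ω) → PTree ar => e (τ (node ω us)))
        (fun us j => e (τ (us j))) := by
      intro us us' h
      exact congrArg e (hcongr ω us us' fun j => e.injective (congrFun h j))
    exact (hfac.extend_apply _ ts).symm
  · intro t
    simp [τ]

end PTree

/-! ### A pushdown automaton evaluating trees in Polish notation -/

theorem List.take_succ_ofFn_update {α : Type*} {n : ℕ} (g : Fin n → α) (k : Fin n) (a : α) :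
    (List.ofFn (Function.update g k a)).take (k + 1) = (List.ofFn g).take k ++ [a] := by
  refine List.ext_getElem (by simp) fun i h1 h2 => ?_
  simp only [List.length_take, List.length_ofFn] at h1
  rcases Nat.lt_or_ge i k with h | h
  · rw [List.getElem_append_left (by simp; omega)]
    simp only [List.getElem_take, List.getElem_ofFn]
    rw [Function.update_of_ne (by simp [Fin.ext_iff]; omega)]
  · obtain rfl : i = k := by omega
    simp

namespace PTree

section Evaluator

variable {Ω : Type*} {ar : Ω → ℕ} {N n : ℕ} (e : Ω ≃ Fin N) (st : PTree ar → Fin n)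
  (δ : ∀ ω, (Fin (ar ω) → Fin n) → Fin n) (F : Set (Fin n))

/-- Stack symbols of the evaluator: `none` is the bottom, and `some ⟨i, k, f⟩` is a vertex with the
`i`-th label whose first `k` branches have been read, `f` giving their states. -/
abbrev EvalStack (ar : Ω → ℕ) (n : ℕ) (e : Ω ≃ Fin N) : Type :=
  Option (Σ i : Fin N, Fin (ar (e.symm i)) × (Fin (ar (e.symm i)) → Fin n))

/-- The stack symbol of a vertex none of whose branches has been read; the states are
placeholders. -/
def freshVertex (har : ∀ ω, 1 ≤ ar ω) (i : Fin N) : EvalStack ar n e :=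
  some ⟨i, ⟨0, har _⟩, fun _ => st leaf⟩

open Classical in
/-- Transitions of the evaluator. Its states are: `none`, about to read a tree; `some (some s)`,
having read a tree of state `s`; `some none`, accepting. -/
noncomputable def evalStep (har : ∀ ω, 1 ≤ ar ω) : Option (Option (Fin n)) → Option (Option Ω) →
    EvalStack ar n e → Option (Option (Option (Fin n)) × List (EvalStack ar n e))
  | none, some none, Z => some (some (some (st leaf)), [Z])
  | none, some (some ω), Z => some (none, [freshVertex e st har (e ω), Z])
  | some (some s), none, some ⟨i, k, f⟩ =>
      if h : k + 1 < ar (e.symm i) then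
        some (none, [some ⟨i, ⟨k + 1, h⟩, Function.update f k s⟩])
      else some (some (some (δ _ (Function.update f k s))), [])
  | some (some s), none, none => if s ∈ F then some (some none, []) else none
  | _, _, _ => none

/-- The pushdown automaton that reads a tree in Polish notation and computes its state. -/
noncomputable def evaluator (har : ∀ ω, 1 ≤ ar ω) : DPDA (Option Ω) where
  State := Option (Option (Fin n))
  Stack := EvalStack ar n e
  finState := inferInstance
  finStack := inferInstance
  start := none
  bottom := none
  accept := {some none}
  step := evalStep e st δ F har
  det q Z h a := by
    rcases q with _ | _ | s
    · simp [evalStep] at h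
    · simp [evalStep] at h
    · simp [evalStep]

/-- `ReadPrefix e st γ u`: if the evaluator is about to read a tree and its stack is `γ`, then it
has read the word `u`, which ends inside the vertices on the stack. -/
inductive ReadPrefix : List (EvalStack ar n e) → List (Option Ω) → Prop
  | bottom : ReadPrefix [none] []
  | vertex {γ : List (EvalStack ar n e)} {u : List (Option Ω)} (i : Fin N)
      (k : Fin (ar (e.symm i))) (f : Fin (ar (e.symm i)) → Fin n)
      (ts : Fin (ar (e.symm i)) → PTree ar) (hγ : ReadPrefix γ u)
      (hf : ∀ j, j < k → f j = st (ts j)) :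
      ReadPrefix (some ⟨i, k, f⟩ :: γ)
        (u ++ some (e.symm i) :: ((List.ofFn fun j => polish (ts j)).take k).flatten)

/-- The invariant of the computations of the evaluator on the word `w₀`. -/
def EvalInvariant (w₀ : List (Option Ω)) :
    Option (Option (Fin n)) × List (Option Ω) × List (EvalStack ar n e) → Prop
  | (none, w, γ) => ∃ u, w₀ = u ++ w ∧ ReadPrefix e st γ u
  | (some none, w, _) => ∃ t : PTree ar, w₀ = t.polish ++ w ∧ st t ∈ F
  | (some (some s), w, γ) =>
      ∃ u, ∃ t : PTree ar, w₀ = u ++ (t.polish ++ w) ∧ st t = s ∧ ReadPrefix e st γ u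

variable {δ}

/-- Moves of the evaluator preserve its invariant, so that only trees are accepted. -/
theorem EvalInvariant.move (hst : ∀ ω ts, st (node ω ts) = δ ω fun j => st (ts j))
    (har : ∀ ω, 1 ≤ ar ω) {w₀ : List (Option Ω)}
    {c c' : (evaluator e st δ F har).State × List (Option Ω) × List (evaluator e st δ F har).Stack}
    (hc : EvalInvariant e st F w₀ c) (h : (evaluator e st δ F har).Move c c') :
    EvalInvariant e st F w₀ c' := by
  classical
  cases h with
  | @read q q' a w Z γ γ' h =>
    change evalStep e st δ F har q (some a) Z = some (q', γ') at h
    rcases q with _ | _ | s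
    · obtain ⟨u, rfl, hu⟩ := hc
      rcases a with _ | ω
      · cases h
        exact ⟨u, leaf, by simp [polish], rfl, hu⟩
      · cases h
        refine ⟨_, ?_, ReadPrefix.vertex (e ω) ⟨0, har _⟩ _ (fun _ => leaf) hu ?_⟩
        · simp
        · intro j hj
          exact absurd hj (Nat.not_lt_zero _)
    · simp [evalStep] at h
    · simp [evalStep] at h
  | @silent q q' w Z γ γ' h =>
    change evalStep e st δ F har q none Z = some (q', γ') at h
    rcases q with _ | _ | s
    · simp [evalStep] at h
    · simp [evalStep] at h
    · obtain ⟨u, t, rfl, rfl, hu⟩ := hc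
      cases hu with
      | bottom =>
        simp only [evalStep] at h
        split_ifs at h with hF
        cases h
        exact ⟨t, by simp, hF⟩
      | @vertex γ u i k f ts hγ hf =>
        have hf' : ∀ j, j ≤ k → Function.update f k (st t) j = st (Function.update ts k t j) := by
          intro j hj
          rcases hj.lt_or_eq with hj | rfl
          · rw [Function.update_of_ne hj.ne, Function.update_of_ne hj.ne, hf j hj]
          · simp
        have htake : (List.ofFn fun j => polish (Function.update ts k t j)).take (k + 1)
            = (List.ofFn fun j => polish (ts j)).take k ++ [t.polish] := by
          rw [← List.take_succ_ofFn_update]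
          congr 2
          exact Function.comp_update polish ts k t
        simp only [evalStep] at h
        split_ifs at h with hk
        · cases h
          refine ⟨_, ?_, ReadPrefix.vertex i ⟨k + 1, hk⟩ _ (Function.update ts k t) hγ ?_⟩
          · rw [htake]
            simp
          · intro j hj
            exact hf' j (Nat.lt_succ_iff.1 hj)
        · cases h
          refine ⟨u, node (e.symm i) (Function.update ts k t), ?_, ?_, hγ⟩
          · rw [List.take_of_length_le (by simp; omega)] at htake
            rw [polish, htake]
            simp
          · rw [hst]
            congr 1
            funext j
            exact (hf' j (by rw [Fin.le_def]; omega)).symm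

theorem evaluator_move_read (har : ∀ ω, 1 ≤ ar ω) {q q' : Option (Option (Fin n))} {a : Option Ω}
    {Z : EvalStack ar n e} {γ' : List (EvalStack ar n e)}
    (h : evalStep e st δ F har q (some a) Z = some (q', γ')) (w : List (Option Ω))
    (γ : List (EvalStack ar n e)) :
    (evaluator e st δ F har).Move (q, a :: w, Z :: γ) (q', w, γ' ++ γ) :=
  DPDA.Move.read (M := evaluator e st δ F har) h

theorem evaluator_move_silent (har : ∀ ω, 1 ≤ ar ω) {q q' : Option (Option (Fin n))}
    {Z : EvalStack ar n e} {γ' : List (EvalStack ar n e)}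
    (h : evalStep e st δ F har q none Z = some (q', γ')) (w : List (Option Ω))
    (γ : List (EvalStack ar n e)) :
    (evaluator e st δ F har).Move (q, w, Z :: γ) (q', w, γ' ++ γ) :=
  DPDA.Move.silent (M := evaluator e st δ F har) h

/-- Reading a tree leaves the stack unchanged and ends in the state of the tree. -/
theorem evaluator_reads (hst : ∀ ω ts, st (node ω ts) = δ ω fun j => st (ts j))
    (har : ∀ ω, 1 ≤ ar ω) (t : PTree ar) (w : List (Option Ω)) (Z : EvalStack ar n e)
    (γ : List (EvalStack ar n e)) :
    Relation.ReflTransGen (evaluator e st δ F har).Move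
      ((none, t.polish ++ w, Z :: γ) : Option (Option (Fin n)) × _ × _)
      ((some (some (st t)), w, Z :: γ) : Option (Option (Fin n)) × _ × _) := by
  classical
  induction t generalizing w Z γ with
  | leaf => exact .single (evaluator_move_read e st F har (γ' := [Z]) rfl _ _)
  | node ω ts ih =>
    obtain ⟨i, rfl⟩ := e.symm.surjective ω
    -- The branches from the `k`-th on are read one after the other.
    have key : ∀ (m : ℕ) (k : Fin (ar (e.symm i))) (f : Fin (ar (e.symm i)) → Fin n),
        k + (m + 1) = ar (e.symm i) → (∀ j, j < k → f j = st (ts j)) →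
        Relation.ReflTransGen (evaluator e st δ F har).Move
          ((none, ((List.ofFn fun j => polish (ts j)).drop k).flatten ++ w,
            some ⟨i, k, f⟩ :: Z :: γ) : Option (Option (Fin n)) × _ × List (EvalStack ar n e))
          ((some (some (st (node _ ts))), w, Z :: γ) : Option (Option (Fin n)) × _ × _) := by
      intro m
      induction m with
      | zero =>
        intro k f hk hf
        rw [List.drop_eq_getElem_cons (by simp), List.drop_of_length_le (by simp; omega),
          List.flatten_cons, List.flatten_nil, List.append_nil, List.getElem_ofFn]
        refine (ih k w _ (Z :: γ)).tail ?_
        refine evaluator_move_silent e st F har (γ' := []) ?_ _ _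
        simp only [evalStep]
        rw [dif_neg (by omega), hst]
        congr 5
        funext j
        rcases (show j ≤ k by rw [Fin.le_def]; omega).lt_or_eq with hj | rfl
        · rw [Function.update_of_ne hj.ne, hf j hj]
        · simp
      | succ m ihm =>
        intro k f hk hf
        rw [List.drop_eq_getElem_cons (by simp), List.flatten_cons, List.getElem_ofFn,
          List.append_assoc]
        have hk' : k + 1 < ar (e.symm i) := by omega
        refine (ih k _ _ (Z :: γ)).trans (Relation.ReflTransGen.head ?_
          (ihm ⟨k + 1, hk'⟩ (Function.update f k (st (ts k))) (by simp only; omega) ?_))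
        · refine evaluator_move_silent e st F har
            (γ' := [some ⟨i, ⟨k + 1, hk'⟩, Function.update f k (st (ts k))⟩]) ?_ _ _
          simp only [evalStep]
          rw [dif_pos hk']
        · intro j hj
          rcases (show j ≤ k from Nat.lt_succ_iff.1 hj).lt_or_eq with hj | rfl
          · rw [Function.update_of_ne hj.ne, hf j hj]
          · simp
    refine Relation.ReflTransGen.head ?_ (key (ar (e.symm i) - 1) ⟨0, har _⟩ (fun _ => st leaf)
      (by have := har (e.symm i); simp only; omega)
      fun j hj => absurd hj (Nat.not_lt_zero _))
    refine evaluator_move_read e st F har (γ' := [freshVertex e st har i, Z]) ?_ _ _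
    simp only [evalStep, Equiv.apply_symm_apply]

end Evaluator

theorem isDeterministicContextFree_of_automaton {Ω : Type*} [Finite Ω] {ar : Ω → ℕ} {n : ℕ}
    (har : ∀ ω, 1 ≤ ar ω) (st : PTree ar → Fin n) (δ : ∀ ω, (Fin (ar ω) → Fin n) → Fin n)
    (hst : ∀ ω ts, st (node ω ts) = δ ω fun j => st (ts j)) (F : Set (Fin n)) :
    Language.IsDeterministicContextFree
      ({w | ∃ t : PTree ar, st t ∈ F ∧ t.polish = w} : Language (Option Ω)) := by
  classical
  let e := Finite.equivFin Ω
  refine ⟨evaluator e st δ F har, ?_⟩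
  ext w
  constructor
  · rintro ⟨q, hq, γ, h⟩
    obtain rfl : q = some none := hq
    have hinv : ∀ c, Relation.ReflTransGen (evaluator e st δ F har).Move
        ((none, w, [none]) : Option (Option (Fin n)) × _ × List (EvalStack ar n e)) c →
        EvalInvariant e st F w c := by
      intro c hc
      induction hc with
      | refl => exact ⟨[], rfl, .bottom⟩
      | tail _ h ih => exact ih.move e st F hst har h
    obtain ⟨t, ht, hF⟩ := hinv _ h
    exact ⟨t, hF, by rw [ht, List.append_nil]⟩
  · rintro ⟨t, hF, rfl⟩
    refine ⟨some none, rfl, [], ?_⟩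
    have h := evaluator_reads e st F hst har t [] none []
    rw [List.append_nil] at h
    refine h.tail ?_
    refine evaluator_move_silent e st F har (γ' := []) ?_ _ _
    simp only [evalStep]
    rw [if_pos hF]

end PTree

/-! ### Polynomial systems of equations over a field -/

theorem Derivation.map_finset_prod {R A M ι : Type*} [CommSemiring R] [CommSemiring A] [Algebra R A]
    [AddCommMonoid M] [Module A M] [Module R M] [DecidableEq ι] (D : Derivation R A M)
    (s : Finset ι) (f : ι → A) :
    D (∏ i ∈ s, f i) = ∑ i ∈ s, (∏ j ∈ s.erase i, f j) • D (f i) := by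
  induction s using Finset.induction_on with
  | empty => simp
  | insert a s ha ih =>
    rw [Finset.prod_insert ha, D.leibniz, ih, Finset.sum_insert ha, Finset.erase_insert ha,
      Finset.smul_sum, add_comm]
    congr 1
    refine Finset.sum_congr rfl fun i hi => ?_
    rw [Finset.erase_insert_of_ne (by rintro rfl; exact ha hi),
      Finset.prod_insert (by simp [ha]), smul_smul]

namespace PolySystem

/-- `Edge σ h s s'`: the unknown `s'` occurs in the equation for `s`, where `h s p` tells that the
`p`-th monomial does. -/
def Edge {S E : Type*} {k : E → ℕ} (σ : ∀ p, Fin (k p) → S) (h : S → E → Prop) (s s' : S) : Prop :=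
  ∃ p, h s p ∧ ∃ j, σ p j = s'

variable {S E : Type*} [DecidableEq S] [Fintype E] {k : E → ℕ} (σ : ∀ p, Fin (k p) → S)

/-- The Jacobian matrix at `f` of the system of polynomials `∑ p, e s p * ∏ j, y (σ p j)`, indexed
by `s`, in the variables `y s`. -/
def jacobian {R : Type*} [CommRing R] (e : S → E → R) (f : S → R) : Matrix S S R := fun s s' =>
  ∑ p, e s p * ∑ j, if σ p j = s' then ∏ i ∈ Finset.univ.erase j, f (σ p i) else 0

theorem jacobian_map {R R' : Type*} [CommRing R] [CommRing R'] (φ : R →+* R') (e : S → E → R)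
    (f : S → R) :
    (jacobian σ e f).map φ = jacobian σ (fun s p => φ (e s p)) (fun s => φ (f s)) := by
  ext s s'
  simp only [jacobian, Matrix.map_apply, map_sum, map_mul, apply_ite φ, map_prod, map_zero]

/-- A solution of a polynomial system `y s = c s + ∑ p, e s p * ∏ j, y (σ p j)` over a field of
characteristic zero is algebraic if the Jacobian matrix of the difference of the two sides is
invertible at it: all differentials of the field generated by the solution are then zero. -/
theorem isAlgebraic [Fintype S] {K L : Type*} [Field K] [CharZero K] [Field L] [Algebra K L]
    (e : S → E → K) (c : S → K) (f : S → L)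
    (hf : ∀ s, f s = algebraMap K L (c s)
      + ∑ p, algebraMap K L (e s p) * ∏ j, f (σ p j))
    (hdet : (1 - jacobian σ (fun s p => algebraMap K L (e s p)) f).det ≠ 0) (s : S) :
    IsAlgebraic K (f s) := by
  classical
  -- The solution is considered in the field `N` that it generates, which is finitely generated.
  let N := IntermediateField.adjoin K (Set.range f)
  have hmem : ∀ s, f s ∈ N := fun s => IntermediateField.subset_adjoin _ _ ⟨s, rfl⟩
  let g : S → N := fun s => ⟨f s, hmem s⟩
  have hg : ∀ s, g s = algebraMap K N (c s) + ∑ p, algebraMap K N (e s p) * ∏ j, g (σ p j) := by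
    intro s
    apply (algebraMap N L).injective
    simp only [map_add, map_sum, map_mul, map_prod, ← IsScalarTower.algebraMap_apply K N L]
    exact hf s
  have hdet' : (1 - jacobian σ (fun s p => algebraMap K N (e s p)) g).det ≠ 0 := by
    intro h
    apply hdet
    have h2 : (1 - jacobian σ (fun s p => algebraMap K L (e s p)) f)
        = (algebraMap N L).mapMatrix (1 - jacobian σ (fun s p => algebraMap K N (e s p)) g) := by
      rw [map_sub, map_one, RingHom.mapMatrix_apply, jacobian_map]
      rfl
    rw [h2, ← RingHom.map_det, h, map_zero]
  let D := KaehlerDifferential.D K N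
  have hD : ∀ s, D (g s)
      = ∑ s', jacobian σ (fun s p => algebraMap K N (e s p)) g s s' • D (g s') := by
    intro s
    conv_lhs => rw [hg s]
    simp only [map_add, map_sum, Derivation.map_algebraMap, zero_add, Derivation.leibniz,
      smul_zero, add_zero, Derivation.map_finset_prod, jacobian, Finset.sum_smul]
    rw [Finset.sum_comm]
    refine Finset.sum_congr rfl fun p _ => ?_
    simp only [mul_smul, Finset.sum_smul, ite_smul, zero_smul]
    rw [← Finset.smul_sum, Finset.sum_comm]
    simp
  -- A dual vector turns the relation `(1 - J) df = 0` between differentials into one over `N`.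
  have hD0 : ∀ s, D (g s) = 0 := by
    intro s
    rw [← Module.forall_dual_apply_eq_zero_iff N]
    intro φ
    have := Matrix.eq_zero_of_mulVec_eq_zero hdet' (v := fun s => φ (D (g s))) (by
      funext s
      rw [Matrix.sub_mulVec, Matrix.one_mulVec, Pi.sub_apply, Matrix.mulVec, dotProduct]
      conv_lhs => rw [hD s]
      simp)
    exact congrFun this s
  have hDall : ∀ x : N, D x = 0 := by
    rintro ⟨x, hx⟩
    induction hx using IntermediateField.adjoin_induction with
    | mem x hx => obtain ⟨s, rfl⟩ := hx; exact hD0 s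
    | algebraMap x => exact D.map_algebraMap x
    | add x y hx hy h1 h2 =>
      have := D.map_add ⟨x, hx⟩ ⟨y, hy⟩
      rw [h1, h2, add_zero] at this
      exact this
    | inv x hx h =>
      have := D.leibniz_inv ⟨x, hx⟩
      rw [h, smul_zero] at this
      exact this
    | mul x y hx hy h1 h2 =>
      have := D.leibniz ⟨x, hx⟩ ⟨y, hy⟩
      rw [h1, h2, smul_zero, smul_zero, add_zero] at this
      exact this
  have hsub : Subsingleton (KaehlerDifferential K N) := by
    suffices (⊤ : Submodule N (KaehlerDifferential K N)) ≤ ⊥ from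
      (subsingleton_iff_forall_eq 0).mpr fun y => this trivial
    rw [← KaehlerDifferential.span_range_derivation, Submodule.span_le]
    rintro _ ⟨x, rfl⟩
    exact hDall x
  have : Algebra.FormallyUnramified K N := ⟨hsub⟩
  have : Algebra.EssFiniteType K N :=
    IntermediateField.essFiniteType_iff.2 (IntermediateField.fg_adjoin_of_finite
      (Set.finite_range f))
  have := Algebra.FormallyUnramified.isSeparable K N
  exact (isAlgebraic_algebraMap_iff (algebraMap N L).injective).2
    ((Algebra.IsSeparable.isSeparable K (g s)).isIntegral.isAlgebraic)

/-- If a polynomial system is linear in the unknowns indexed by `C`, with coefficients in a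
subfield `F`, then its solution, as far as indexed by `C`, lies in `F`. -/
theorem mem_subfield_of_linear {L : Type*} [Field L] (F : Subfield L)
    (e : S → E → L) (he : ∀ s p, e s p ∈ F) (c : S → L) (hc : ∀ s, c s ∈ F) (f : S → L)
    (hf : ∀ s, f s = c s + ∑ p, e s p * ∏ j, f (σ p j))
    (C : Finset S)
    (hout : ∀ s ∈ C, ∀ p, e s p ≠ 0 → ∀ j, σ p j ∉ C → f (σ p j) ∈ F)
    (hlin : ∀ s ∈ C, ∀ p, e s p ≠ 0 → ∀ i j, σ p i ∈ C → σ p j ∈ C → i = j)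
    (hdet : (1 - (jacobian σ e f).submatrix ((↑) : C → S) ((↑) : C → S)).det ≠ 0) :
    ∀ s ∈ C, f s ∈ F := by
  classical
  set M := (jacobian σ e f).submatrix ((↑) : C → S) ((↑) : C → S) with hM
  have hMF : ∀ s s', M s s' ∈ F := by
    intro s s'
    simp only [hM, Matrix.submatrix_apply, jacobian]
    refine sum_mem fun p _ => ?_
    by_cases hp : e s p = 0
    · simp [hp]
    refine mul_mem (he _ _) (sum_mem fun j _ => ?_)
    split_ifs with hj
    · refine prod_mem fun i hi => hout s s.2 p hp i fun hi' => ?_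
      exact (Finset.ne_of_mem_erase hi) (hlin s s.2 p hp i j hi' (hj ▸ s'.2))
    · exact zero_mem _
  -- Linearity makes the remainder `b` of `f` after subtraction of `M f` independent of the unknowns
  -- in `C`, so that `f` is the unique solution of a linear system over `F`.
  let b : C → L := fun s => f s - ∑ s' : C, M s s' * f s'
  have hb : ∀ s, b s ∈ F := by
    intro s
    have h1 : b s = c s + ∑ p, e s p * (∏ j, f (σ p j)
        - ∑ j, if σ p j ∈ C then ∏ i, f (σ p i) else 0) := by
      simp only [b, mul_sub, Finset.sum_sub_distrib]
      rw [← add_sub_assoc, ← hf]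
      congr 1
      simp only [hM, Matrix.submatrix_apply, jacobian, Finset.sum_mul]
      rw [Finset.sum_comm]
      refine Finset.sum_congr rfl fun p _ => ?_
      simp only [mul_assoc]
      rw [← Finset.mul_sum]
      congr 1
      simp only [Finset.sum_mul]
      rw [Finset.sum_comm]
      refine Finset.sum_congr rfl fun j _ => ?_
      split_ifs with hj
      · rw [Finset.sum_eq_single ⟨σ p j, hj⟩]
        · rw [if_pos rfl, mul_comm]
          exact Finset.mul_prod_erase Finset.univ (fun i => f (σ p i)) (Finset.mem_univ j)
        · intro s' _ hs'
          rw [if_neg fun h => hs' (Subtype.ext h.symm), zero_mul]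
        · simp
      · refine Finset.sum_eq_zero fun s' _ => ?_
        rw [if_neg fun h => hj (by rw [h]; exact s'.2), zero_mul]
    rw [h1]
    refine add_mem (hc _) (sum_mem fun p _ => ?_)
    by_cases hp : e s p = 0
    · simp [hp]
    refine mul_mem (he _ _) ?_
    by_cases hex : ∃ j, σ p j ∈ C
    · obtain ⟨j, hj⟩ := hex
      rw [Finset.sum_eq_single j, if_pos hj, sub_self]
      · exact zero_mem _
      · intro i _ hij
        rw [if_neg fun hi => hij (hlin s s.2 p hp i j hi hj)]
      · simp
    · push Not at hex
      rw [Finset.sum_eq_zero fun j _ => if_neg (hex j), sub_zero]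
      exact prod_mem fun j _ => hout s s.2 p hp j (hex j)
  let M₀ : Matrix C C F := fun s s' => ⟨M s s', hMF s s'⟩
  let b₀ : C → F := fun s => ⟨b s, hb s⟩
  have hMap : F.subtype.mapMatrix (1 - M₀) = 1 - M := by
    rw [map_sub, map_one]
    rfl
  have hdet₀ : IsUnit (1 - M₀).det := by
    rw [isUnit_iff_ne_zero]
    intro h
    apply hdet
    rw [← hMap, ← RingHom.map_det, h, map_zero]
  let u := (1 - M₀)⁻¹.mulVec b₀
  have hu : (1 - M₀).mulVec u = b₀ := by
    rw [Matrix.mulVec_mulVec, Matrix.mul_nonsing_inv _ hdet₀, Matrix.one_mulVec]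
  have hsub : (fun s : C => f s) - (fun s => (u s : L)) = 0 := by
    apply Matrix.eq_zero_of_mulVec_eq_zero hdet
    rw [Matrix.mulVec_sub, sub_eq_zero]
    have h1 : (1 - M).mulVec (fun s : C => f s) = b := by
      rw [Matrix.sub_mulVec, Matrix.one_mulVec]
      rfl
    have h2 : (1 - M).mulVec (fun s => (u s : L)) = b := by
      funext s
      have := congrArg F.subtype (congrFun hu s)
      rw [← hMap]
      rw [RingHom.map_mulVec] at this
      exact this
    rw [h1, h2]
  intro s hs
  have := congrFun hsub ⟨s, hs⟩
  simp only [Pi.sub_apply, Pi.zero_apply, sub_eq_zero] at this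
  rw [this]
  exact (u _).2

/-- If no monomial in the equation of an unknown `s` contains two factors that both depend on `s`,
then each strongly connected component of the dependency graph is a linear system over the
components below it, and the solution lies in every field containing the coefficients. -/
theorem mem_subfield_of_not_branching [Fintype S] {L : Type*} [Field L] (F : Subfield L)
    (e : S → E → L) (he : ∀ s p, e s p ∈ F) (c : S → L) (hc : ∀ s, c s ∈ F) (f : S → L)
    (hf : ∀ s, f s = c s + ∑ p, e s p * ∏ j, f (σ p j))
    (hdet : ∀ C : Finset S, (1 - (jacobian σ e f).submatrix ((↑) : C → S) ((↑) : C → S)).det ≠ 0)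
    (hbr : ∀ s p, e s p ≠ 0 → ∀ i j,
      Relation.ReflTransGen (Edge σ fun s p => e s p ≠ 0) (σ p i) s →
      Relation.ReflTransGen (Edge σ fun s p => e s p ≠ 0) (σ p j) s → i = j) (s : S) :
    f s ∈ F := by
  classical
  set R := Relation.ReflTransGen (Edge σ fun s p => e s p ≠ 0) with hR
  -- Induction on the number of unknowns on which `s` depends.
  induction hn : (Finset.univ.filter (R s)).card using Nat.strong_induction_on generalizing s with
  | _ n ih =>
  subst hn
  refine mem_subfield_of_linear σ F e he c hc f hf (Finset.univ.filter fun s' => R s s' ∧ R s' s)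
    ?_ ?_ (hdet _) s (by simpa using Relation.ReflTransGen.refl)
  · intro s' hs' p hp j hj
    obtain ⟨h1, h2⟩ : R s s' ∧ R s' s := by simpa using hs'
    have h3 : R s (σ p j) := h1.tail ⟨p, hp, j, rfl⟩
    refine ih _ (Finset.card_lt_card ?_) (σ p j) rfl
    refine (Finset.ssubset_iff_of_subset ?_).2 ⟨s, ?_, ?_⟩
    · intro a
      simp only [Finset.mem_filter, Finset.mem_univ, true_and]
      exact h3.trans
    · simpa using Relation.ReflTransGen.refl
    · simpa using fun h => hj (by simpa using ⟨h3, h⟩)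
  · intro s' hs' p hp i j hi hj
    simp only [Finset.mem_filter, Finset.mem_univ, true_and] at hs' hi hj
    obtain ⟨h1, h2⟩ := hs'
    exact hbr s' p hp i j (hi.2.trans h1) (hj.2.trans h1)

end PolySystem

/-! ### Power series with natural coefficients -/

namespace PowerSeries

theorem coeff_mul_le_coeff_mul {a b c d : PowerSeries ℕ} (h₁ : ∀ n, coeff n a ≤ coeff n b)
    (h₂ : ∀ n, coeff n c ≤ coeff n d) (n : ℕ) : coeff n (a * c) ≤ coeff n (b * d) := by
  simp only [coeff_mul]
  exact Finset.sum_le_sum fun p _ => Nat.mul_le_mul (h₁ _) (h₂ _)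

theorem exists_coeff_X_pow_le {g : PowerSeries ℕ} (hg : g ≠ 0) :
    ∃ m, ∀ n, coeff n (X ^ m : PowerSeries ℕ) ≤ coeff n g := by
  obtain ⟨m, hm⟩ := (PowerSeries.exists_coeff_ne_zero_iff_ne_zero).2 hg
  refine ⟨m, fun n => ?_⟩
  rw [coeff_X_pow]
  split_ifs with h
  · subst h; exact Nat.one_le_iff_ne_zero.2 hm
  · exact Nat.zero_le _

/-- The inequality `X ^ m * g ^ 2 ≤ g` makes the coefficients of `g` double along an arithmetic
progression. -/
theorem not_isSubexponential_of_sq_le {g : PowerSeries ℕ} (hg : g ≠ 0)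
    (hg0 : constantCoeff g = 0) (m : ℕ)
    (h : ∀ n, coeff n (X ^ m * (g * g)) ≤ coeff n g) :
    ¬ IsSubexponential fun n => coeff n g := by
  obtain ⟨n₀, hn₀⟩ := (PowerSeries.exists_coeff_ne_zero_iff_ne_zero).2 hg
  have hpos : 0 < n₀ := by
    rcases Nat.eq_zero_or_pos n₀ with rfl | h
    · rw [coeff_zero_eq_constantCoeff_apply] at hn₀; exact absurd hg0 hn₀
    · exact h
  have key : ∀ i, coeff (i + n₀) (g * g) ≤ coeff (i + (n₀ + m)) g := by
    intro i
    have := h (i + n₀ + m)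
    rwa [coeff_X_pow_mul, add_assoc] at this
  have hbase : 1 ≤ coeff (n₀ + (n₀ + m)) g := by
    refine le_trans ?_ (key n₀)
    rw [coeff_mul]
    refine le_trans ?_ (Finset.single_le_sum (fun _ _ => Nat.zero_le _)
      (Finset.HasAntidiagonal.mem_antidiagonal (a := ((n₀, n₀) : ℕ × ℕ)).2 rfl))
    exact Nat.mul_pos (Nat.pos_of_ne_zero hn₀) (Nat.pos_of_ne_zero hn₀)
  -- For `i ≠ n₀` the two products of the `i`-th and the `n₀`-th coefficient are distinct terms.
  have hstep : ∀ i, i ≠ n₀ → 2 * coeff i g ≤ coeff (i + (n₀ + m)) g := by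
    intro i hi
    refine le_trans ?_ (key i)
    rw [coeff_mul]
    have hsub : ({(i, n₀), (n₀, i)} : Finset (ℕ × ℕ))
        ⊆ Finset.HasAntidiagonal.antidiagonal (i + n₀) := by
      intro p hp
      simp only [Finset.mem_insert, Finset.mem_singleton] at hp
      rcases hp with rfl | rfl <;> simp [add_comm]
    refine le_trans ?_ (Finset.sum_le_sum_of_subset hsub)
    rw [Finset.sum_pair (by simp [hi])]
    have h1 : 1 ≤ coeff n₀ g := Nat.one_le_iff_ne_zero.2 hn₀
    nlinarith [Nat.mul_le_mul_left (coeff i g) h1]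
  have hpow : ∀ k, 2 ^ k ≤ coeff (n₀ + (k + 1) * (n₀ + m)) g := by
    intro k
    induction k with
    | zero => simpa using hbase
    | succ k ih =>
      have h1 := hstep (n₀ + (k + 1) * (n₀ + m)) (by
        have : 0 < (k + 1) * (n₀ + m) := by positivity
        omega)
      rw [show n₀ + (k + 1 + 1) * (n₀ + m) = n₀ + (k + 1) * (n₀ + m) + (n₀ + m) by ring, pow_succ]
      omega
  intro hsub
  set e := n₀ + m with he
  have hepos : (0 : ℝ) < e := by exact_mod_cast (by omega : 0 < e)
  -- The base `c` is chosen so that `c ^ e = √2`, which is less than `2`.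
  have hc : (1 : ℝ) < (2 : ℝ) ^ ((1 : ℝ) / (2 * e)) :=
    Real.one_lt_rpow (by norm_num) (by positivity)
  have hce : ((2 : ℝ) ^ ((1 : ℝ) / (2 * e))) ^ e = √2 := by
    rw [← Real.rpow_natCast, ← Real.rpow_mul (by norm_num), Real.sqrt_eq_rpow]
    congr 1
    field_simp
  set c := (2 : ℝ) ^ ((1 : ℝ) / (2 * e)) with hcdef
  have htend : Filter.Tendsto (fun k : ℕ => n₀ + (k + 1) * e) Filter.atTop Filter.atTop := by
    refine Filter.tendsto_atTop_mono (fun k => ?_) Filter.tendsto_id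
    have : k * 1 ≤ k * e := Nat.mul_le_mul_left k (by omega)
    simp only [id]
    nlinarith
  have h1 := htend.eventually (hsub c hc)
  have h2 : (1 : ℝ) < √2 := by
    rw [Real.lt_sqrt] <;> norm_num
  have h3 := (tendsto_pow_atTop_atTop_of_one_lt h2).eventually
    (Filter.eventually_gt_atTop (c ^ n₀ * c ^ e))
  obtain ⟨k, hk1, hk2⟩ := (h1.and h3).exists
  have h4 : (2 : ℝ) ^ k ≤ c ^ (n₀ + (k + 1) * e) :=
    le_trans (by exact_mod_cast hpow k) hk1
  have h5 : c ^ (n₀ + (k + 1) * e) = (c ^ n₀ * c ^ e) * √2 ^ k := by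
    rw [← hce]; ring
  have h6 : (2 : ℝ) ^ k = √2 ^ k * √2 ^ k := by
    rw [← mul_pow, Real.mul_self_sqrt (by norm_num)]
  rw [h5, h6] at h4
  exact absurd (le_of_mul_le_mul_right h4 (by positivity)) (not_le.2 hk2)

end PowerSeries

namespace PolySystem

variable {S E : Type*} {k : E → ℕ} (σ : ∀ p, Fin (k p) → S)

/-- `LinearEdge σ h s s'`: the unknown `s'` is by itself a monomial in the equation for `s`. -/
def LinearEdge {S E : Type*} {k : E → ℕ} (σ : ∀ p, Fin (k p) → S) (h : S → E → Prop) (s s' : S) :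
    Prop :=
  ∃ p, h s p ∧ ∃ j, σ p j = s' ∧ ∀ i, i = j

/-- The number of indices reachable from `s` decreases along the edges, so that the matrix is
nilpotent. -/
theorem isNilpotent_of_acyclic [Fintype S] [DecidableEq S] {R : Type*} [CommRing R]
    (A : Matrix S S R) (r : S → S → Prop)
    (hA : ∀ s s', A s s' ≠ 0 → r s s') (hr : ∀ s, ¬ Relation.TransGen r s s) : IsNilpotent A := by
  classical
  let ρ : S → ℕ := fun s => (Finset.univ.filter (Relation.TransGen r s)).card
  have hρ : ∀ s s', r s s' → ρ s' < ρ s := by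
    intro s s' h
    refine Finset.card_lt_card ((Finset.ssubset_iff_of_subset ?_).2 ⟨s', ?_, ?_⟩)
    · intro a
      simp only [Finset.mem_filter, Finset.mem_univ, true_and]
      exact Relation.TransGen.head h
    · simpa using Relation.TransGen.single h
    · simpa using hr s'
  have key : ∀ n s s', (A ^ n) s s' ≠ 0 → n + ρ s' ≤ ρ s := by
    intro n
    induction n with
    | zero =>
      intro s s' h
      rw [pow_zero] at h
      have : s = s' := by
        by_contra hne
        exact h (Matrix.one_apply_ne hne)
      simp [this]
    | succ n ih =>
      intro s s' h
      rw [pow_succ, Matrix.mul_apply] at h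
      obtain ⟨a, -, ha⟩ := Finset.exists_ne_zero_of_sum_ne_zero h
      have h1 := ih s a (left_ne_zero_of_mul ha)
      have h2 := hρ a s' (hA _ _ (right_ne_zero_of_mul ha))
      omega
  refine ⟨Fintype.card S + 1, ?_⟩
  ext s s'
  by_contra h
  have h1 := key _ s s' h
  have h2 : ρ s ≤ Fintype.card S := Finset.card_le_univ _
  omega

/-- At a solution without constant terms, the Jacobian matrix has as constant part the matrix of
the linear terms. If these form no cycle, it is nilpotent, and `1 - jacobian` is nonsingular. -/
theorem det_one_sub_jacobian_ne_zero [Fintype S] [DecidableEq S] [Fintype E]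
    (e : S → E → PowerSeries ℤ) (f : S → PowerSeries ℤ)
    (hf : ∀ s, PowerSeries.constantCoeff (f s) = 0)
    (hacyc : ∀ s, ¬ Relation.TransGen (LinearEdge σ fun s p => e s p ≠ 0) s s) (C : Finset S) :
    (1 - (jacobian σ e f).submatrix ((↑) : C → S) ((↑) : C → S)).det ≠ 0 := by
  classical
  intro h
  have h1 := congrArg PowerSeries.constantCoeff h
  rw [RingHom.map_det, map_sub, map_one, map_zero] at h1
  have hnil : IsNilpotent (PowerSeries.constantCoeff.mapMatrix
      ((jacobian σ e f).submatrix ((↑) : C → S) ((↑) : C → S))) := by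
    refine isNilpotent_of_acyclic _
      (fun s s' : C => LinearEdge σ (fun s p => e s p ≠ 0) s s') ?_ ?_
    · intro s s' hne
      simp only [RingHom.mapMatrix_apply, Matrix.map_apply, Matrix.submatrix_apply, jacobian,
        map_sum, map_mul] at hne
      obtain ⟨p, -, hp⟩ := Finset.exists_ne_zero_of_sum_ne_zero hne
      refine ⟨p, fun h0 => left_ne_zero_of_mul hp (by rw [h0, map_zero]), ?_⟩
      obtain ⟨j, -, hj⟩ := Finset.exists_ne_zero_of_sum_ne_zero (right_ne_zero_of_mul hp)
      split_ifs at hj with hjs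
      · refine ⟨j, hjs, fun i => ?_⟩
        by_contra hij
        rw [map_prod] at hj
        exact hj (Finset.prod_eq_zero (Finset.mem_erase.2 ⟨hij, Finset.mem_univ i⟩) (hf _))
      · simp at hj
    · intro s hs
      exact hacyc s (Relation.TransGen.lift ((↑) : C → S) (fun _ _ h => h) s s hs)
  have h2 := (Matrix.isUnit_iff_isUnit_det _).1 hnil.isUnit_one_sub
  rw [h1] at h2
  exact not_isUnit_zero h2

open PowerSeries in
/-- If the unknown `s'` occurs in the equations on which `s` depends, then `X ^ m * g s' ≤ g s`. -/
theorem exists_coeff_X_pow_mul_le (h : S → E → Prop) (g : S → PowerSeries ℕ) (hg : ∀ s, g s ≠ 0)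
    (hle : ∀ s p, h s p → ∀ n, coeff n (∏ j, g (σ p j)) ≤ coeff n (g s)) {s s' : S}
    (hs : Relation.ReflTransGen (Edge σ h) s s') :
    ∃ m, ∀ n, coeff n (X ^ m * g s') ≤ coeff n (g s) := by
  classical
  induction hs with
  | refl => exact ⟨0, fun n => by simp⟩
  | tail _ h2 ih =>
    obtain ⟨m, hm⟩ := ih
    obtain ⟨p, hp, j, rfl⟩ := h2
    obtain ⟨m', hm'⟩ := exists_coeff_X_pow_le
      (Finset.prod_ne_zero_iff.2 fun i (_ : i ∈ Finset.univ.erase j) => hg (σ p i))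
    refine ⟨m + m', fun n => le_trans ?_ (hm n)⟩
    rw [pow_add, mul_assoc]
    refine coeff_mul_le_coeff_mul (fun _ => le_rfl) (fun n => le_trans ?_ (hle _ p hp n)) n
    rw [← Finset.prod_erase_mul Finset.univ _ (Finset.mem_univ j)]
    exact coeff_mul_le_coeff_mul hm' (fun _ => le_rfl) n

open PowerSeries in
/-- A monomial in the equation of `s` with two factors that depend on `s` forces exponential
growth. -/
theorem not_isSubexponential_of_branching (h : S → E → Prop) (g : S → PowerSeries ℕ)
    (hg : ∀ s, g s ≠ 0) (hg0 : ∀ s, constantCoeff (g s) = 0)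
    (hle : ∀ s p, h s p → ∀ n, coeff n (∏ j, g (σ p j)) ≤ coeff n (g s)) {s : S} {p : E}
    (hp : h s p) {i j : Fin (k p)} (hij : i ≠ j)
    (hi : Relation.ReflTransGen (Edge σ h) (σ p i) s)
    (hj : Relation.ReflTransGen (Edge σ h) (σ p j) s) :
    ¬ IsSubexponential fun n => coeff n (g s) := by
  classical
  obtain ⟨a, ha⟩ := exists_coeff_X_pow_mul_le σ h g hg hle hi
  obtain ⟨b, hb⟩ := exists_coeff_X_pow_mul_le σ h g hg hle hj
  obtain ⟨c, hc⟩ := exists_coeff_X_pow_le (Finset.prod_ne_zero_iff.2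
    fun l (_ : l ∈ (Finset.univ.erase j).erase i) => hg (σ p l))
  refine not_isSubexponential_of_sq_le (hg s) (hg0 s) (c + a + b) fun n =>
    le_trans ?_ (hle s p hp n)
  rw [← Finset.prod_erase_mul Finset.univ _ (Finset.mem_univ j),
    ← Finset.prod_erase_mul (Finset.univ.erase j) _ (Finset.mem_erase.2 ⟨hij, Finset.mem_univ i⟩),
    show (X ^ (c + a + b) * (g s * g s) : PowerSeries ℕ)
      = X ^ c * (X ^ a * g s) * (X ^ b * g s) by ring]
  exact coeff_mul_le_coeff_mul (coeff_mul_le_coeff_mul hc ha) hb n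

end PolySystem

theorem PowerSeries.algebraMap_fractionRing_polynomial
    [Algebra (FractionRing (Polynomial ℤ)) (FractionRing (PowerSeries ℤ))]
    [IsScalarTower (Polynomial ℤ) (FractionRing (Polynomial ℤ)) (FractionRing (PowerSeries ℤ))]
    (p : Polynomial ℤ) :
    algebraMap (FractionRing (Polynomial ℤ)) (FractionRing (PowerSeries ℤ)) (algebraMap _ _ p)
      = algebraMap (PowerSeries ℤ) _ (p : PowerSeries ℤ) := by
  rw [← IsScalarTower.algebraMap_apply, IsScalarTower.algebraMap_apply (Polynomial ℤ)
    (PowerSeries ℤ) (FractionRing (PowerSeries ℤ))]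
  congr 1

/-- A power series is rational if and only if it lies in the field of fractions of the polynomial
ring, inside the field of fractions of the ring of power series. -/
theorem PowerSeries.isRational_iff_mem_fieldRange
    [Algebra (FractionRing (Polynomial ℤ)) (FractionRing (PowerSeries ℤ))]
    [IsScalarTower (Polynomial ℤ) (FractionRing (Polynomial ℤ)) (FractionRing (PowerSeries ℤ))]
    (f : PowerSeries ℤ) :
    f.IsRational ↔ algebraMap (PowerSeries ℤ) (FractionRing (PowerSeries ℤ)) f ∈
      (algebraMap (FractionRing (Polynomial ℤ)) (FractionRing (PowerSeries ℤ))).fieldRange := by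
  have hinj := IsFractionRing.injective (PowerSeries ℤ) (FractionRing (PowerSeries ℤ))
  constructor
  · rintro ⟨p, q, hq, h⟩
    refine ⟨algebraMap _ _ p / algebraMap _ _ q, ?_⟩
    have hq' : algebraMap (PowerSeries ℤ) (FractionRing (PowerSeries ℤ)) (q : PowerSeries ℤ)
        ≠ 0 := by
      rw [Ne, map_eq_zero_iff _ hinj]
      exact_mod_cast hq
    rw [map_div₀, algebraMap_fractionRing_polynomial, algebraMap_fractionRing_polynomial,
      div_eq_iff hq', ← h, map_mul, mul_comm]
  · rintro ⟨y, hy⟩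
    obtain ⟨p, q, hq, rfl⟩ := IsFractionRing.div_surjective (A := Polynomial ℤ) y
    have hq0 := nonZeroDivisors.ne_zero hq
    have hq' : algebraMap (PowerSeries ℤ) (FractionRing (PowerSeries ℤ)) (q : PowerSeries ℤ)
        ≠ 0 := by
      rw [Ne, map_eq_zero_iff _ hinj]
      exact_mod_cast hq0
    refine ⟨p, q, hq0, hinj ?_⟩
    rw [map_div₀, algebraMap_fractionRing_polynomial, algebraMap_fractionRing_polynomial,
      div_eq_iff hq'] at hy
    rw [map_mul, hy, mul_comm]

namespace PolySystem

open PowerSeries in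
/-- Power series that count the terms derived from the nonterminals of an unambiguous context-free
grammar without cycles of unit rules: they are algebraic, and rational if they grow
subexponentially. -/
theorem isAlgebraic_and_isRational {S E : Type*} [Fintype S] [Fintype E] {k : E → ℕ}
    (σ : ∀ p, Fin (k p) → S) (h : S → E → Prop) [∀ s p, Decidable (h s p)] (c : S → Polynomial ℤ)
    (g : S → PowerSeries ℕ)
    (hg : ∀ s, g s ≠ 0) (hg0 : ∀ s, constantCoeff (g s) = 0)
    (hsys : ∀ s, map (Nat.castRingHom ℤ) (g s) = (c s : PowerSeries ℤ)
      + ∑ p, if h s p then ∏ j, map (Nat.castRingHom ℤ) (g (σ p j)) else 0)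
    (hle : ∀ s p, h s p → ∀ n, coeff n (∏ j, g (σ p j)) ≤ coeff n (g s))
    (hacyc : ∀ s, ¬ Relation.TransGen (LinearEdge σ h) s s) :
    IsAlgebraic (Polynomial ℤ) (∑ s, map (Nat.castRingHom ℤ) (g s)) ∧
    ((∀ s, IsSubexponential fun n => coeff n (g s)) →
      (∑ s, map (Nat.castRingHom ℤ) (g s)).IsRational) := by
  classical
  let K := FractionRing (Polynomial ℤ)
  let L := FractionRing (PowerSeries ℤ)
  have : FaithfulSMul (Polynomial ℤ) L := by
    rw [faithfulSMul_iff_algebraMap_injective, IsScalarTower.algebraMap_eq (Polynomial ℤ)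
      (PowerSeries ℤ) L]
    refine (IsFractionRing.injective (PowerSeries ℤ) L).comp ?_
    intro p q hpq
    simpa [PowerSeries.algebraMap_apply'] using hpq
  let : Algebra K L := FractionRing.liftAlgebra (Polynomial ℤ) L
  have : IsScalarTower (Polynomial ℤ) K L := FractionRing.isScalarTower_liftAlgebra _ _
  let e : S → E → PowerSeries ℤ := fun s p => if h s p then 1 else 0
  let f : S → PowerSeries ℤ := fun s => map (Nat.castRingHom ℤ) (g s)
  have he : ∀ s p, e s p ≠ 0 ↔ h s p := fun s p => by simp [e]
  have he' : (fun s p => e s p ≠ 0) = h := by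
    funext s p
    exact propext (he s p)
  have hdet : ∀ C : Finset S, (1 - (jacobian σ (fun s p => algebraMap _ L (e s p))
      (fun s => algebraMap _ L (f s))).submatrix ((↑) : C → S) ((↑) : C → S)).det ≠ 0 := by
    intro C h0
    have h1 := det_one_sub_jacobian_ne_zero σ e f (fun s => by
      simp only [f, ← coeff_zero_eq_constantCoeff_apply, coeff_map]
      simp [hg0]) (by rw [he']; exact hacyc) C
    apply h1
    apply IsFractionRing.injective (PowerSeries ℤ) L
    rw [map_zero, RingHom.map_det, ← h0, map_sub, map_one]
    congr 2
    rw [← jacobian_map]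
    rfl
  have hcoe : ∀ p : Polynomial ℤ, algebraMap K L (algebraMap _ _ p)
      = algebraMap (PowerSeries ℤ) _ (p : PowerSeries ℤ) := algebraMap_fractionRing_polynomial
  have hsys' : ∀ s, algebraMap _ L (f s) = algebraMap _ L (c s : PowerSeries ℤ)
      + ∑ p, algebraMap _ L (e s p) * ∏ j, algebraMap _ L (f (σ p j)) := by
    intro s
    simp only [← map_prod, ← map_mul, ← map_sum, ← map_add]
    congr 1
    simp only [f, e]
    rw [hsys s]
    simp
  have heK : ∀ s p, algebraMap K L (if h s p then 1 else 0) = algebraMap _ L (e s p) := by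
    intro s p
    simp only [e]
    split_ifs <;> simp
  constructor
  · refine sum_mem (S := Subalgebra.algebraicClosure _ _) fun s _ => ?_
    rw [Subalgebra.mem_algebraicClosure]
    refine (isAlgebraic_algebraMap_iff (IsFractionRing.injective (PowerSeries ℤ) L)).1 ?_
    rw [IsFractionRing.isAlgebraic_iff (Polynomial ℤ) K]
    refine isAlgebraic σ (fun s p => if h s p then 1 else 0) (fun s => algebraMap _ K (c s))
      (fun s => algebraMap _ L (f s)) ?_ ?_ s
    · intro s
      simp only [heK, hcoe]
      exact hsys' s
    · simp only [heK]
      have h1 := hdet Finset.univ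
      intro h0
      apply h1
      rw [← h0]
      refine Eq.trans ?_
        (Matrix.det_submatrix_equiv_self (Equiv.subtypeUnivEquiv Finset.mem_univ) _)
      rw [Matrix.submatrix_sub, Pi.sub_apply, Pi.sub_apply, Matrix.submatrix_one_equiv]
      rfl
  · intro hsub
    rw [PowerSeries.isRational_iff_mem_fieldRange, map_sum]
    refine sum_mem fun s _ => ?_
    refine mem_subfield_of_not_branching σ (algebraMap K L).fieldRange
      (fun s p => algebraMap _ L (e s p)) (fun s p => ⟨_, heK s p⟩)
      (fun s => algebraMap _ L (c s : PowerSeries ℤ)) (fun s => ⟨_, hcoe (c s)⟩)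
      (fun s => algebraMap _ L (f s)) hsys' hdet ?_ s
    have he2 : (fun s p => algebraMap _ L (e s p) ≠ 0) = h := by
      rw [← he']
      funext s p
      rw [Ne, map_eq_zero_iff _ (IsFractionRing.injective (PowerSeries ℤ) L)]
    rw [he2]
    intro s p hp i j hi hj
    by_contra hij
    rw [map_ne_zero_iff _ (IsFractionRing.injective (PowerSeries ℤ) L), he] at hp
    exact not_isSubexponential_of_branching σ h g hg hg0 hle hp hij hi hj (hsub s)

end PolySystem

/-! ### Generating series of weighted types -/

/-- The generating series of a type with weight function `w`; it is meaningful if there are only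
finitely many elements of each weight. -/
noncomputable def countSeries {α : Type*} (w : α → ℕ) : PowerSeries ℕ :=
  PowerSeries.mk fun m => Nat.card {a // w a = m}

theorem countSeries_congr {α β : Type*} {v : α → ℕ} {w : β → ℕ} (e : α ≃ β)
    (h : ∀ a, w (e a) = v a) : countSeries v = countSeries w := by
  ext m
  simp only [countSeries, PowerSeries.coeff_mk]
  exact Nat.card_congr (e.subtypeEquiv fun a => by rw [h])

theorem countSeries_sum {α β : Type*} {v : α → ℕ} {w : β → ℕ} (hv : ∀ m, Finite {a // v a = m})
    (hw : ∀ m, Finite {b // w b = m}) :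
    countSeries (Sum.elim v w) = countSeries v + countSeries w := by
  ext m
  have := hv m
  have := hw m
  simp only [countSeries, PowerSeries.coeff_mk, map_add]
  rw [← Nat.card_sum]
  exact Nat.card_congr Equiv.subtypeSum

theorem countSeries_sigma {ι : Type*} [Fintype ι] {α : ι → Type*} {w : ∀ i, α i → ℕ}
    (hw : ∀ i m, Finite {a // w i a = m}) :
    countSeries (fun x : Σ i, α i => w x.1 x.2) = ∑ i, countSeries (w i) := by
  ext m
  have := fun i => hw i m
  simp only [countSeries, PowerSeries.coeff_mk, map_sum]
  rw [← Nat.card_sigma]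
  exact Nat.card_congr
    { toFun := fun x => ⟨x.1.1, x.1.2, x.2⟩
      invFun := fun x => ⟨⟨x.1, x.2.1⟩, x.2.2⟩
      left_inv := fun _ => rfl
      right_inv := fun _ => rfl }

/-- Families of total weight `m` are distributed according to the weights of their members. -/
noncomputable def piWeightEquiv {ι : Type*} [Fintype ι] [DecidableEq ι] {α : ι → Type*}
    (w : ∀ i, α i → ℕ) (m : ℕ) :
    {x : ∀ i, α i // ∑ i, w i (x i) = m} ≃
      Σ l : {l // l ∈ Finset.finsuppAntidiag (Finset.univ : Finset ι) m},
        ∀ i, {a // w i a = l.1 i} where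
  toFun x := ⟨⟨Finsupp.equivFunOnFinite.symm fun i => w i (x.1 i), by
    simpa [Finset.mem_finsuppAntidiag] using x.2⟩, fun i => ⟨x.1 i, rfl⟩⟩
  invFun y := ⟨fun i => (y.2 i).1, by
    exact (Finset.sum_congr rfl fun i _ => (y.2 i).2).trans
      (Finset.mem_finsuppAntidiag.1 y.1.2).1⟩
  left_inv _ := rfl
  right_inv := by
    rintro ⟨⟨l, hl⟩, y⟩
    obtain ⟨x, hx, rfl⟩ : ∃ x : ∀ i, α i, ∃ hx : ∀ i, w i (x i) = l i, y = fun i => ⟨x i, hx i⟩ :=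
      ⟨fun i => (y i).1, fun i => (y i).2, rfl⟩
    obtain rfl : l = Finsupp.equivFunOnFinite.symm fun i => w i (x i) := by
      ext i
      exact (hx i).symm
    rfl

theorem finite_pi_weight {ι : Type*} [Fintype ι] {α : ι → Type*} {w : ∀ i, α i → ℕ}
    (hw : ∀ i m, Finite {a // w i a = m}) (m : ℕ) :
    Finite {x : ∀ i, α i // ∑ i, w i (x i) = m} := by
  classical
  exact Finite.of_equiv _ (piWeightEquiv w m).symm

theorem countSeries_pi {ι : Type*} [Fintype ι] {α : ι → Type*} {w : ∀ i, α i → ℕ}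
    (hw : ∀ i m, Finite {a // w i a = m}) :
    countSeries (fun x : ∀ i, α i => ∑ i, w i (x i)) = ∏ i, countSeries (w i) := by
  classical
  ext m
  rw [PowerSeries.coeff_prod]
  simp only [countSeries, PowerSeries.coeff_mk]
  rw [Nat.card_congr (piWeightEquiv w m), Nat.card_sigma]
  simp only [Nat.card_pi]
  exact Finset.sum_coe_sort (Finset.finsuppAntidiag (Finset.univ : Finset ι) m)
    fun l => ∏ i, Nat.card {a // w i a = l i}

/-! ### Counting trees by their states -/

theorem IsSubexponential.mono {a b : ℕ → ℕ} (hb : IsSubexponential b) (h : ∀ n, a n ≤ b n) :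
    IsSubexponential a := fun c hc =>
  (hb c hc).mono fun n hn => le_trans (by exact_mod_cast h n) hn

namespace PTree

variable {Ω : Type*} {ar : Ω → ℕ}

theorem one_le_leaves (har : ∀ ω, 1 ≤ ar ω) (t : PTree ar) : 1 ≤ t.leaves := by
  induction t with
  | leaf => exact le_rfl
  | node ω ts ih =>
    exact (ih ⟨0, har ω⟩).trans
      (Finset.single_le_sum (f := fun j => leaves (ts j)) (fun _ _ => Nat.zero_le _)
        (Finset.mem_univ _))

theorem finite_leaves_eq [Finite Ω] (har : ∀ ω, 2 ≤ ar ω) (n : ℕ) :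
    {t : PTree ar | t.leaves = n}.Finite := by
  induction n using Nat.strong_induction_on with
  | _ n ih =>
  have hlt : {t : PTree ar | t.leaves < n}.Finite := by
    have : {t : PTree ar | t.leaves < n} = ⋃ m ∈ Set.Iio n, {t | t.leaves = m} := by
      ext t
      simp
    rw [this]
    exact (Set.finite_Iio n).biUnion ih
  have : Finite {t : PTree ar // t.leaves < n} := hlt.to_subtype
  refine ((Set.finite_singleton leaf).union (Set.finite_range
    fun p : Σ ω, Fin (ar ω) → {t : PTree ar // t.leaves < n} =>
      node p.1 fun j => (p.2 j).1)).subset ?_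
  rintro (_ | ⟨ω, ts⟩) ht
  · exact Or.inl rfl
  · refine Or.inr ⟨⟨ω, fun j => ⟨ts j, ?_⟩⟩, rfl⟩
    have : Nontrivial (Fin (ar ω)) := Fin.nontrivial_iff_two_le.2 (har ω)
    obtain ⟨i, hij⟩ := exists_ne j
    have h1 := Finset.sum_le_sum_of_subset (f := fun l => leaves (ts l))
      (Finset.subset_univ {i, j})
    rw [Finset.sum_pair hij] at h1
    have h2 := one_le_leaves (fun ω => one_le_two.trans (har ω)) (ts i)
    have h3 : ∑ l, leaves (ts l) = n := ht
    omega

/-- The number of internal vertices. -/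
def vertices : PTree ar → ℕ
  | leaf => 0
  | node _ ts => 1 + ∑ j, vertices (ts j)

section States

variable {n : ℕ} (st : PTree ar → Fin n) (δ : ∀ ω, (Fin (ar ω) → Fin n) → Fin n) (F : Set (Fin n))

/-- The accepting states that are attained by trees. -/
abbrev LiveState : Type := {s : Fin n // s ∈ F ∧ ∃ t, st t = s}

/-- A production of the tree grammar: a label together with states of the branches. -/
abbrev Production : Type _ := Σ ω : Ω, Fin (ar ω) → LiveState st F

/-- The production `p` derives from the nonterminal `s`. -/
def Derives (s : LiveState st F) (p : Production st F) : Prop :=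
  δ p.1 (fun j => (p.2 j).1) = s.1

/-- The generating series, by arity, of the trees of a given state. -/
noncomputable def stateSeries (s : LiveState st F) : PowerSeries ℕ :=
  countSeries fun t : {t // st t = s.1} => leaves t.1

variable {δ F}

/-- Unique readability: a tree of state `s` is a free end, or its root is given by one production
that derives from `s`. -/
noncomputable def treeEquiv (hst : ∀ ω ts, st (node ω ts) = δ ω fun j => st (ts j))
    (hF : ∀ ω ts j, st (node ω ts) ∈ F → st (ts j) ∈ F) (s : LiveState st F) :
    {_u : Unit // st leaf = s.1} ⊕
      (Σ p : {p // Derives st δ F s p}, ∀ j, {t // st t = (p.1.2 j).1}) ≃ {t // st t = s.1} :=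
  Equiv.ofBijective
    (Sum.elim (fun u => ⟨leaf, u.2⟩) fun x => ⟨node x.1.1.1 fun j => (x.2 j).1, by
      rw [hst]
      simp only [(x.2 _).2]
      exact x.1.2⟩) (by
    constructor
    · rintro (u | ⟨⟨⟨ω, τ⟩, hp⟩, ts⟩) (u' | ⟨⟨⟨ω', τ'⟩, hp'⟩, ts'⟩) h
      · exact congrArg Sum.inl (Subsingleton.elim u u')
      · simp at h
      · simp at h
      · simp only [Sum.elim_inr, Subtype.mk.injEq, node.injEq] at h
        obtain ⟨rfl, h⟩ := h
        have hts : ∀ j, (ts j).1 = (ts' j).1 := fun j => congrFun (eq_of_heq h) j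
        obtain rfl : τ = τ' := by
          funext j
          exact Subtype.ext (((ts j).2.symm.trans (congrArg st (hts j))).trans (ts' j).2)
        obtain rfl : ts = ts' := by
          funext j
          exact Subtype.ext (hts j)
        rfl
    · rintro ⟨_ | ⟨ω, ts⟩, ht⟩
      · exact ⟨Sum.inl ⟨(), ht⟩, rfl⟩
      · refine ⟨Sum.inr ⟨⟨⟨ω, fun j => ⟨st (ts j), hF ω ts j (ht ▸ s.2.1), ts j, rfl⟩⟩, ?_⟩,
          fun j => ⟨ts j, rfl⟩⟩, rfl⟩
        rw [hst] at ht
        exact ht)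

noncomputable instance : Fintype (LiveState st F) := Fintype.ofFinite _

noncomputable instance [Finite Ω] : Fintype (Production st F) :=
  have := Fintype.ofFinite Ω
  Fintype.ofFinite _

theorem finite_state_leaves (hfin : ∀ m, {t : PTree ar | st t ∈ F ∧ t.leaves = m}.Finite)
    (s : LiveState st F) (m : ℕ) : Finite {t : {t // st t = s.1} // t.1.leaves = m} := by
  have := (hfin m).to_subtype
  refine Finite.of_injective (β := {t : PTree ar | st t ∈ F ∧ t.leaves = m})
    (fun t => ⟨t.1.1, t.1.2.symm ▸ s.2.1, t.2⟩) ?_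
  intro t t' h
  exact Subtype.ext (Subtype.ext (Subtype.mk.inj h))

open Classical in
/-- The system of polynomial equations satisfied by the generating series. -/
theorem stateSeries_eq [Finite Ω] (hst : ∀ ω ts, st (node ω ts) = δ ω fun j => st (ts j))
    (hF : ∀ ω ts j, st (node ω ts) ∈ F → st (ts j) ∈ F)
    (hfin : ∀ m, {t : PTree ar | st t ∈ F ∧ t.leaves = m}.Finite) (s : LiveState st F) :
    stateSeries st F s = (if st leaf = s.1 then PowerSeries.X else 0)
      + ∑ p, if Derives st δ F s p then ∏ j, stateSeries st F (p.2 j) else 0 := by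
  have hfib := finite_state_leaves st hfin
  have h1 : stateSeries st F s = countSeries (Sum.elim
      (fun _ : {_u : Unit // st leaf = s.1} => 1)
      (fun x : Σ p : {p // Derives st δ F s p}, ∀ j, {t // st t = (p.1.2 j).1} =>
        ∑ j, leaves (x.2 j).1)) := by
    refine (countSeries_congr (treeEquiv st hst hF s) ?_).symm
    rintro (u | x) <;> rfl
  rw [h1, countSeries_sum (fun m => inferInstance)]
  · congr 1
    · split_ifs with h
      · ext m
        simp only [countSeries, PowerSeries.coeff_mk, PowerSeries.coeff_X]
        split_ifs with hm
        · subst hm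
          have : Unique {a : {_u : Unit // st leaf = s.1} // 1 = 1} :=
            ⟨⟨⟨⟨(), h⟩, rfl⟩⟩, fun _ => rfl⟩
          exact Nat.card_unique
        · have : IsEmpty {a : {_u : Unit // st leaf = s.1} // 1 = m} :=
            ⟨fun a => hm a.2.symm⟩
          exact Nat.card_of_isEmpty
      · ext m
        simp only [countSeries, PowerSeries.coeff_mk, map_zero]
        have : IsEmpty {a : {_u : Unit // st leaf = s.1} // 1 = m} := ⟨fun a => h a.1.2⟩
        exact Nat.card_of_isEmpty
    · rw [countSeries_sigma (w := fun (p : {p // Derives st δ F s p})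
        (x : ∀ j, {t // st t = (p.1.2 j).1}) => ∑ j, leaves (x j).1)
        fun p m => finite_pi_weight (fun j m => hfib (p.1.2 j) m) m]
      rw [← Finset.sum_filter, Finset.sum_subtype (p := Derives st δ F s)
        (F := inferInstance) _ (by simp)]
      exact Finset.sum_congr rfl fun p _ => countSeries_pi fun j m => hfib (p.1.2 j) m
  · intro m
    have := fun p : {p // Derives st δ F s p} =>
      finite_pi_weight (fun j m => hfib (p.1.2 j) m) m
    refine Finite.of_injective (β := Σ p : {p // Derives st δ F s p},
      {x : ∀ j, {t // st t = (p.1.2 j).1} // ∑ j, leaves (x j).1 = m})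
      (fun x => ⟨x.1.1, x.1.2, x.2⟩) ?_
    rintro ⟨⟨p, x⟩, hx⟩ ⟨⟨p', x'⟩, hx'⟩ h
    cases h
    rfl

/-- A cycle of productions with a single branch would give infinitely many trees of the same
arity. -/
theorem not_transGen_linearEdge (hst : ∀ ω ts, st (node ω ts) = δ ω fun j => st (ts j))
    (hfin : ∀ m, {t : PTree ar | st t ∈ F ∧ t.leaves = m}.Finite) (s : LiveState st F) :
    ¬ Relation.TransGen (PolySystem.LinearEdge (E := Production st F) (fun p => p.2)
      (Derives st δ F)) s s := by
  have key : ∀ s s' : LiveState st F, Relation.TransGen (PolySystem.LinearEdge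
      (E := Production st F) (fun p => p.2) (Derives st δ F)) s s' → ∀ t', st t' = s'.1 →
      ∃ t, st t = s.1 ∧ t.leaves = t'.leaves ∧ t'.vertices < t.vertices := by
    have hone : ∀ s s' : LiveState st F, PolySystem.LinearEdge
        (E := Production st F) (fun p => p.2) (Derives st δ F) s s' → ∀ t', st t' = s'.1 →
        ∃ t, st t = s.1 ∧ t.leaves = t'.leaves ∧ t'.vertices < t.vertices := by
      rintro s s' ⟨⟨ω, τ⟩, hp, j, hj, huniq⟩ t' ht'
      have : Unique (Fin (ar ω)) := ⟨⟨j⟩, huniq⟩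
      refine ⟨node ω fun _ => t', ?_, ?_, ?_⟩
      · rw [hst, ← hp]
        congr 1
        funext i
        rw [huniq i, ht', ← hj]
      · simp [leaves]
      · simp [vertices]
    intro s s' h
    induction h with
    | single h => exact hone _ _ h
    | tail _ h ih =>
      intro t' ht'
      obtain ⟨t₁, h1, h2, h3⟩ := hone _ _ h t' ht'
      obtain ⟨t₂, h4, h5, h6⟩ := ih t₁ h1
      exact ⟨t₂, h4, h5.trans h2, h3.trans h6⟩
  intro hs
  obtain ⟨t, ht⟩ := s.2.2
  obtain ⟨t', ⟨h1, h2⟩, hmax⟩ := Set.exists_max_image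
    {u : PTree ar | st u = s.1 ∧ u.leaves = t.leaves} vertices
    ((hfin t.leaves).subset fun u hu => ⟨hu.1 ▸ s.2.1, hu.2⟩) ⟨t, ht, rfl⟩
  obtain ⟨u, h3, h4, h5⟩ := key s s hs t' h1
  exact absurd h5 (not_lt.2 (hmax u ⟨h3, h4.trans h2⟩))

/-- The generating series of the trees accepted by a finite tree automaton. Branches of accepted
trees have to be accepted as well, so that all states that occur have finite counts. -/
theorem isAlgebraic_and_isRational_of_automaton [Finite Ω] (har : ∀ ω, 1 ≤ ar ω)
    (hst : ∀ ω ts, st (node ω ts) = δ ω fun j => st (ts j))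
    (hF : ∀ ω ts j, st (node ω ts) ∈ F → st (ts j) ∈ F)
    (hfin : ∀ m, {t : PTree ar | st t ∈ F ∧ t.leaves = m}.Finite) :
    IsAlgebraic (Polynomial ℤ) (PowerSeries.mk fun m =>
      (Nat.card {t : PTree ar // st t ∈ F ∧ t.leaves = m} : ℤ)) ∧
    (IsSubexponential (fun m => Nat.card {t : PTree ar // st t ∈ F ∧ t.leaves = m}) →
      (PowerSeries.mk fun m =>
        (Nat.card {t : PTree ar // st t ∈ F ∧ t.leaves = m} : ℤ)).IsRational) := by
  classical
  have hcard : ∀ m, Nat.card {t : PTree ar // st t ∈ F ∧ t.leaves = m}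
      = ∑ s, PowerSeries.coeff m (stateSeries st F s) := by
    intro m
    have hfib := fun s => finite_state_leaves st hfin s m
    simp only [stateSeries, countSeries, PowerSeries.coeff_mk]
    rw [← Nat.card_sigma]
    exact Nat.card_congr
      { toFun := fun t => ⟨⟨st t.1, t.2.1, t.1, rfl⟩, ⟨t.1, rfl⟩, t.2.2⟩
        invFun := fun x => ⟨x.2.1.1, x.2.1.2.symm ▸ x.1.2.1, x.2.2⟩
        left_inv := fun _ => rfl
        right_inv := by
          rintro ⟨⟨s, hs⟩, ⟨⟨t, h⟩, ht⟩⟩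
          obtain rfl : st t = s := h
          rfl }
  have hsum : (PowerSeries.mk fun m => (Nat.card {t : PTree ar // st t ∈ F ∧ t.leaves = m} : ℤ))
      = ∑ s, PowerSeries.map (Nat.castRingHom ℤ) (stateSeries st F s) := by
    ext m
    rw [PowerSeries.coeff_mk, hcard]
    simp
  have hsys := stateSeries_eq st hst hF hfin
  have hmain := PolySystem.isAlgebraic_and_isRational (E := Production st F) (fun p => p.2)
    (Derives st δ F) (fun s => if st leaf = s.1 then Polynomial.X else 0) (stateSeries st F)
    (by
      intro s h0
      obtain ⟨t, ht⟩ := s.2.2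
      have := finite_state_leaves st hfin s t.leaves
      have : Nonempty {u : {t // st t = s.1} // u.1.leaves = t.leaves} := ⟨⟨⟨t, ht⟩, rfl⟩⟩
      have h1 := congrArg (PowerSeries.coeff t.leaves) h0
      rw [stateSeries, countSeries, PowerSeries.coeff_mk, map_zero] at h1
      exact Nat.card_pos.ne' h1)
    (by
      intro s
      rw [← PowerSeries.coeff_zero_eq_constantCoeff_apply, stateSeries, countSeries,
        PowerSeries.coeff_mk]
      have : IsEmpty {t : {t // st t = s.1} // t.1.leaves = 0} :=
        ⟨fun t => by have := one_le_leaves har t.1.1; have := t.2; omega⟩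
      exact Nat.card_of_isEmpty)
    (by
      intro s
      rw [hsys s]
      simp only [map_add, map_sum, apply_ite (PowerSeries.map (Nat.castRingHom ℤ)), map_zero,
        PowerSeries.map_X, map_prod]
      congr 1
      split_ifs <;> simp)
    (by
      intro s p hp m
      rw [hsys s, map_add, map_sum]
      refine le_trans ?_ (Nat.le_add_left _ _)
      refine le_trans ?_ (Finset.single_le_sum (fun _ _ => Nat.zero_le _) (Finset.mem_univ p))
      rw [if_pos hp])
    (not_transGen_linearEdge st hst hfin)
  rw [hsum]
  refine ⟨hmain.1, fun hsub => hmain.2 fun s => hsub.mono fun m => ?_⟩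
  rw [hcard]
  exact Finset.single_le_sum (f := fun s => PowerSeries.coeff m (stateSeries st F s))
    (fun _ _ => Nat.zero_le _) (Finset.mem_univ s)

end States

end PTree

/-! ### Operads with a finite Gröbner basis -/

/-- The normal monomials as a basis of a component of the operad. -/
noncomputable def IsGroebnerBasis.basis {K : Type*} [Field K] {Ω : Type*} {ar : Ω → ℕ}
    {P : ℕ → Type*} [∀ n, AddCommGroup (P n)] [∀ n, Module K (P n)] [NSOperad K P]
    {π : NSOperad.Hom K (FreeNS K ar) P} {o : TreeMonOrder ar} {G : Set (Σ n, FreeNS K ar n)}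
    (hG : IsGroebnerBasis π o G) (n : ℕ) (hπ : Function.Surjective (π.toFun n)) :
    Module.Basis {t : TreeMon ar n // IsNormalMonomial o G t.1} K (P n) :=
  Module.Basis.mk (hG.linearIndependent n) (hG.span_eq_top n hπ).ge

theorem mainTheorem1 {K : Type*} [Field K]
    -- the operad
    {P : ℕ → Type*} [∀ n, AddCommGroup (P n)] [∀ n, Module K (P n)] [NSOperad K P]
    -- a finite set of generators, presenting the operad as a quotient of the free one
    {Ω : Type*} [Finite Ω] (ar : Ω → ℕ) (har : ∀ ω, 1 ≤ ar ω)
    (π : NSOperad.Hom K (FreeNS K ar) P) (hπ : ∀ n, Function.Surjective (π.toFun n))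
    -- a finite Groebner basis of the ideal of relations
    (o : TreeMonOrder ar) (G : Set (Σ n, FreeNS K ar n)) (hfin : G.Finite)
    (hG : IsGroebnerBasis π o G) :
    -- the normal monomials form a basis of the operad
    (∀ n, LinearIndependent K
        (fun t : {t : TreeMon ar n // IsNormalMonomial o G t.1} =>
          π.toFun n (Finsupp.single t.1 1)) ∧
      Submodule.span K (Set.range
        (fun t : {t : TreeMon ar n // IsNormalMonomial o G t.1} =>
          π.toFun n (Finsupp.single t.1 1))) = ⊤) ∧
    -- in Polish notation this basis is a deterministic context-free language `L(X|Y)`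
    (∃ Y : Set (PTree ar), Y.Finite ∧
      ({w | ∃ t : PTree ar, IsNormalMonomial o G t ∧ t.polish = w} : Language (Option Ω))
        = PTree.avoidanceLanguage Y ∧
      (PTree.avoidanceLanguage Y).IsDeterministicContextFree) ∧
    -- the components are finite-dimensional if there are no unary generators
    ((∀ ω, 2 ≤ ar ω) → ∀ n, Module.Finite K (P n)) ∧
    -- the generating series
    ((∀ n, Module.Finite K (P n)) →
      IsAlgebraic (Polynomial ℤ) (operadSeries K P) ∧
      (IsSubexponential (fun n => Module.finrank K (P n)) → (operadSeries K P).IsRational)) := by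
  obtain ⟨n, st, δ, F, hst, hav⟩ := PTree.exists_automaton (finite_leadingMonomials o hfin)
  have hlang : (PTree.avoidanceLanguage (leadingMonomials o G))
      = ({w | ∃ t : PTree ar, st t ∈ F ∧ t.polish = w} : Language (Option Ω)) := by
    ext w
    exact exists_congr fun t => and_congr_left fun _ => hav t
  have hcard : ∀ m, {t : TreeMon ar m // IsNormalMonomial o G t.1}
      ≃ {t : PTree ar // st t ∈ F ∧ t.leaves = m} := fun m =>
    { toFun := fun t => ⟨t.1.1, (hav _).1 t.2, t.1.2⟩
      invFun := fun t => ⟨⟨t.1, t.2.2⟩, (hav _).2 t.2.1⟩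
      left_inv := fun _ => rfl
      right_inv := fun _ => rfl }
  refine ⟨fun m => ⟨hG.linearIndependent m, hG.span_eq_top m (hπ m)⟩,
    ⟨leadingMonomials o G, finite_leadingMonomials o hfin, rfl, ?_⟩, fun h2 m => ?_, fun hfd => ?_⟩
  · rw [hlang]
    exact PTree.isDeterministicContextFree_of_automaton har st δ hst F
  · have : Finite (TreeMon ar m) := (PTree.finite_leaves_eq h2 m).to_subtype
    exact Module.Finite.of_basis (hG.basis m (hπ m))
  · have hdim : ∀ m, Module.finrank K (P m)
        = Nat.card {t : PTree ar // st t ∈ F ∧ t.leaves = m} := fun m => by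
      rw [Module.finrank_eq_nat_card_basis (hG.basis m (hπ m)), Nat.card_congr (hcard m)]
    have hfin' : ∀ m, {t : PTree ar | st t ∈ F ∧ t.leaves = m}.Finite := by
      intro m
      have := Module.Finite.finite_basis (hG.basis m (hπ m))
      exact Set.finite_coe_iff.1 (Finite.of_equiv _ (hcard m))
    have hsub : ∀ ω ts j, st (PTree.node ω ts) ∈ F → st (ts j) ∈ F := fun ω ts j h =>
      (hav _).1 ((PTree.avoids_node.1 ((hav _).2 h)).2 j)
    have hmain := PTree.isAlgebraic_and_isRational_of_automaton st har hst hsub hfin'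
    simp only [operadSeries, hdim]
    exact hmain
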